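/- **Setting.** Let $d\in\mathbb N$, $0\le\xi<d-3$, and fix $\gamma,L,M>0$ and constants $C_1,C_2>0$ and $0<c_1<\tfrac12 e^{-2(2-\xi)/(2+\xi)}$. Let $x\mapsto K(\|x\|)$ be a nonnegative, compactly supported, Hölder continuous kernel on $\mathbb R^d$ with integral $1$, and let $C_0$ be the diameter of its support. For a law $P$ of $(X,Y)$ with marginal $P_X$, put $f_P(x)=\mathbb E(Y\mid X=x)$ and, for $\sigma>0$, $p_\sigma(x)=\int\sigma^{-d}K(\|x-u\|/\sigma)\,dP_X(u)$. For $\alpha\ge 0$ let $$D_{P,\alpha,\sigma}(x_1,x_2)=\inf_\gamma\int_0^{L(\gamma)}e^{-\alpha p_\sigma(\gamma(t))}\,dt,$$ the infimum being over the unit-speed curves $\gamma$ in $\mathbb R^d$ of finite length $L(\gamma)$ from $x_1$ to $x_2$. Let $\mathcal N(P,\alpha,\sigma,\varepsilon)$ be the smallest number of closed $D_{P,\alpha,\sigma}$-balls of radius $\varepsilon$ that cover the support of $P_X$. For $n,m\ge1$ let $\mathcal Q_n(\alpha,\sigma)$ be the set of laws $P$ such that, almost surely, $X\in[0,1]^d$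 and $|Y|\le M$; such that $f_P$ has a version with $|f_P(x_1)-f_P(x_2)|\le L\,D_{P,\alpha,\sigma}(x_1,x_2)$ on $[0,1]^d$; and such that $$\mathcal N(P,\alpha,\sigma,\varepsilon)\le (C_1/\varepsilon)^\xi\quad\text{for all }\varepsilon\text{ with } c_1n^{-1/(2+\xi)}\le\varepsilon\le C_1 .$$ Call $(\alpha,\sigma)$ admissible if $\alpha\ge0$, $\alpha\,\varepsilon(m,\sigma)\le\log 2$ with $\varepsilon(m,\sigma)=\sqrt{C_2\log m/(m\sigma^d)}$, and $$m^{-1/(d(1+\gamma))}\le\sigma\le\frac1{4C_0}\,n^{-1/(d-1)} .$$ From i.i.d. labeled points $(X_1,Y_1),\dots,(X_n,Y_n)\sim P$ and independent i.i.d. unlabeled points $X_{n+1},\dots,X_{n+m}\sim P_X$, let $\hat p_\sigma(x)=\frac1m\sum_{j=1}^m\sigma^{-d}K(\|x-X_{n+j}\|/\sigma)$, let $\hat D_{\alpha,\sigma}$ be defined as $D_{P,\alpha,\sigma}$ with $\hat p_\sigma$ in place of $p_\sigma$, and let $$\hat f_{h,\alpha,\sigma}(x)=\frac{\sum_{i=1}^nY_i\,Q_h(\hat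 D_{\alpha,\sigma}(x,X_i))}{\sum_{i=1}^nQ_h(\hat D_{\alpha,\sigma}(x,X_i))},\qquad Q_h(t)=h^{-d}\,I(|t|\le h),\quad 0/0=0 .$$ Its risk is $R_P(\hat f)=\mathbb E_P\int(\hat f(x)-f_P(x))^2\,dP_X(x)$. **Theorem.** Let $h=(ne^{2(2-\xi)})^{-1/(2+\xi)}$. There is a constant $C>0$, depending only on $d,\xi,\gamma,L,M,c_1,C_1,C_2,K$, such that for all $n,m\ge1$ $$\sup_{(\alpha,\sigma)\ \text{admissible}}\ \ \sup_{P\in\mathcal Q_n(\alpha,\sigma)}R_P(\hat f_{h,\alpha,\sigma})\ \le\ \Bigl(\frac Cn\Bigr)^{2/(2+\xi)} .$$ -/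

import Mathlib

open MeasureTheory ProbabilityTheory Set
open scoped ENNReal NNReal

noncomputable section

namespace DensitySensitive

/-- The covariate space `ℝ^d` with its Euclidean norm. -/
abbrev Pt (d : ℕ) : Type := EuclideanSpace ℝ (Fin d)

/-- The unit cube `[0,1]^d`. -/
def cube (d : ℕ) : Set (Pt d) := {x | ∀ i, x i ∈ Icc (0 : ℝ) 1}

/-- `K : ℝ → ℝ` is the radial profile of a kernel on `ℝ^d`: the function `x ↦ K ‖x‖` is a
compactly supported probability density, Hölder continuous of some exponent. -/
structure IsSmoothingKernel (d : ℕ) (K : ℝ → ℝ) : Prop where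
  nonneg : ∀ x : Pt d, 0 ≤ K ‖x‖
  compact_support : HasCompactSupport (fun x : Pt d => K ‖x‖)
  holder : ∃ A β : ℝ≥0, 0 < β ∧ HolderWith A β (fun x : Pt d => K ‖x‖)
  integral_eq_one : ∫ x : Pt d, K ‖x‖ = 1

/-- The diameter `C₀` of the support of the kernel `x ↦ K ‖x‖` on `ℝ^d`. -/
def kernelDiam (d : ℕ) (K : ℝ → ℝ) : ℝ := Metric.diam (tsupport (fun x : Pt d => K ‖x‖))

/-- The smoothed density `p_σ(x) = ∫ σ^{-d} K(‖x - u‖ / σ) dμ(u)`. -/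
def smoothedDensity {d : ℕ} (K : ℝ → ℝ) (σ : ℝ) (μ : Measure (Pt d)) (x : Pt d) : ℝ :=
  ∫ u, (σ ^ d)⁻¹ * K (‖x - u‖ / σ) ∂μ

/-- The kernel density estimate `(1/m) ∑ σ^{-d} K(‖x - U_j‖ / σ)` from the points `U`. -/
def kde {d m : ℕ} (K : ℝ → ℝ) (σ : ℝ) (U : Fin m → Pt d) (x : Pt d) : ℝ :=
  (1 / (m : ℝ)) * ∑ j, (σ ^ d)⁻¹ * K (‖x - U j‖ / σ)

/-- `γ : [0, ℓ] → ℝ^d` is a continuous curve of finite length `ℓ` from `x` to `y` with unit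
speed (it is parametrized by arc length). -/
structure IsUnitSpeedCurve {d : ℕ} (x y : Pt d) (ℓ : ℝ) (γ : ℝ → Pt d) : Prop where
  length_nonneg : 0 ≤ ℓ
  continuousOn : ContinuousOn γ (Icc 0 ℓ)
  unit_speed : HasUnitSpeedOn γ (Icc 0 ℓ)
  source : γ 0 = x
  target : γ ℓ = y

/-- The exponential metric of a function `p`: the infimum over the unit-speed curves `γ` from
`x` to `y` of `∫_0^{L(γ)} exp(-α p(γ(t))) dt`. -/
def expMetric {d : ℕ} (α : ℝ) (p : Pt d → ℝ) (x y : Pt d) : ℝ :=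
  sInf {c | ∃ (ℓ : ℝ) (γ : ℝ → Pt d), IsUnitSpeedCurve x y ℓ γ ∧
    c = ∫ t in (0 : ℝ)..ℓ, Real.exp (-α * p (γ t))}

/-- The smallest number of balls `{z | D x z ≤ ε}` needed to cover `S` (`⊤` if no finite number
suffices). -/
def coveringNumber {d : ℕ} (D : Pt d → Pt d → ℝ) (S : Set (Pt d)) (ε : ℝ) : ℕ∞ :=
  ⨅ (c : Finset (Pt d)) (_ : ∀ z ∈ S, ∃ x ∈ c, D x z ≤ ε), (c.card : ℕ∞)

/-- The marginal law `P_X`. -/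
def marginal {d : ℕ} (P : Measure (Pt d × ℝ)) : Measure (Pt d) := P.map Prod.fst

/-- The regression function `f_P(x) = E(Y | X = x)`, the mean of the conditional law of `Y`. -/
def regression {d : ℕ} (P : Measure (Pt d × ℝ)) [IsFiniteMeasure P] (x : Pt d) : ℝ :=
  ∫ y, y ∂(P.condKernel x)

/-- The density-sensitive metric `D_{P,α,σ}`. -/
def populationMetric {d : ℕ} (K : ℝ → ℝ) (α σ : ℝ) (P : Measure (Pt d × ℝ)) :
    Pt d → Pt d → ℝ :=
  expMetric α (smoothedDensity K σ (marginal P))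

/-- The estimated metric, computed from the unlabeled points `U`. -/
def estimatedMetric {d m : ℕ} (K : ℝ → ℝ) (α σ : ℝ) (U : Fin m → Pt d) :
    Pt d → Pt d → ℝ :=
  expMetric α (kde K σ U)

/-- The class `𝓟(α, σ, L)` of laws of `(X, Y)` with `X ∈ [0,1]^d` and `|Y| ≤ M` almost surely
whose regression function has a version that is `L`-Lipschitz for `D_{P,α,σ}` on the cube. -/
def smoothClass (d : ℕ) (K : ℝ → ℝ) (L M α σ : ℝ) : Set (ProbabilityMeasure (Pt d × ℝ)) :=
  {P | (∀ᵐ z ∂(P : Measure (Pt d × ℝ)), z.1 ∈ cube d ∧ |z.2| ≤ M) ∧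
    ∃ f : Pt d → ℝ, f =ᵐ[marginal (P : Measure (Pt d × ℝ))] regression P ∧
      ∀ x₁ ∈ cube d, ∀ x₂ ∈ cube d,
        |f x₁ - f x₂| ≤ L * populationMetric K α σ (P : Measure (Pt d × ℝ)) x₁ x₂}

/-- The class `𝓠(α, σ, L)` at sample size `n`: the members of `𝓟(α, σ, L)` such that the support
of `P_X` has covering number at most `(C₁/ε)^ξ` for every `ε ∈ [c₁ n^{-1/(2+ξ)}, C₁]`. -/
def coveringClass (d : ℕ) (K : ℝ → ℝ) (L M ξ c₁ C₁ : ℝ) (n : ℕ) (α σ : ℝ) :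
    Set (ProbabilityMeasure (Pt d × ℝ)) :=
  {P | P ∈ smoothClass d K L M α σ ∧
    ∀ ε : ℝ, c₁ * (1 / (n : ℝ)) ^ (1 / (2 + ξ)) ≤ ε → ε ≤ C₁ →
      ((coveringNumber (populationMetric K α σ (P : Measure (Pt d × ℝ)))
        (marginal (P : Measure (Pt d × ℝ))).support ε : ℕ∞) : ℝ≥0∞)
        ≤ ENNReal.ofReal ((C₁ / ε) ^ ξ)}

/-- `ε(m, σ) = √(C₂ log m / (m σ^d))`. -/
def deviation (d : ℕ) (C₂ : ℝ) (m : ℕ) (σ : ℝ) : ℝ :=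
  Real.sqrt (C₂ * Real.log m / (m * σ ^ d))

/-- The constraints on the parameters: `0 ≤ α ≤ log 2 / ε(m, σ)`, multiplied out, and
`(1/m)^{1/(d(1+γ))} ≤ σ ≤ (1/(4 C₀)) (1/n)^{1/(d-1)}`. -/
structure Admissible (d : ℕ) (K : ℝ → ℝ) (γ C₂ : ℝ) (n m : ℕ) (α σ : ℝ) : Prop where
  alpha_nonneg : 0 ≤ α
  alpha_le : α * deviation d C₂ m σ ≤ Real.log 2
  sigma_ge : (1 / (m : ℝ)) ^ (1 / ((d : ℝ) * (1 + γ))) ≤ σ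
  sigma_le : σ ≤ 1 / (4 * kernelDiam d K) * (1 / (n : ℝ)) ^ (1 / ((d : ℝ) - 1))

/-- The rescaled box kernel `Q_h(t) = h^{-d} Q(t/h)` with `Q(t) = 1` if `|t| ≤ 1` and `0`
otherwise. -/
def boxKernel (d : ℕ) (h t : ℝ) : ℝ := (h ^ d)⁻¹ * Set.indicator {s : ℝ | |s| ≤ 1} 1 (t / h)

/-- The semisupervised kernel estimator, from the labeled data `Z` and the unlabeled data `U`
(with `0/0 = 0`). -/
def estimator {d n m : ℕ} (K : ℝ → ℝ) (h α σ : ℝ) (Z : Fin n → Pt d × ℝ) (U : Fin m → Pt d)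
    (x : Pt d) : ℝ :=
  (∑ i, (Z i).2 * boxKernel d h (estimatedMetric K α σ U x (Z i).1)) /
    ∑ i, boxKernel d h (estimatedMetric K α σ U x (Z i).1)

/-- The risk `E_P ∫ (f̂(x) - f_P(x))² dP_X(x)` of an estimator that uses `n` labeled points drawn
from `P` and `m` unlabeled points drawn from `P_X`, all independent. -/
def risk {d n m : ℕ} (P : ProbabilityMeasure (Pt d × ℝ))
    (fhat : (Fin n → Pt d × ℝ) → (Fin m → Pt d) → Pt d → ℝ) : ℝ≥0∞ :=
  ∫⁻ w : (Fin n → Pt d × ℝ) × (Fin m → Pt d),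
    (∫⁻ x, ENNReal.ofReal ((fhat w.1 w.2 x - regression (P : Measure (Pt d × ℝ)) x) ^ 2)
      ∂(marginal (P : Measure (Pt d × ℝ))))
    ∂((Measure.pi fun _ : Fin n => (P : Measure (Pt d × ℝ))).prod
      (Measure.pi fun _ : Fin m => marginal (P : Measure (Pt d × ℝ))))

/-- The bandwidth `h = (n e^{2(2-ξ)})^{-1/(2+ξ)}`. -/
def bandwidth (ξ : ℝ) (n : ℕ) : ℝ := ((n : ℝ) * Real.exp (2 * (2 - ξ))) ^ (-1 / (2 + ξ))

end DensitySensitive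

end

/-! Condition on the unlabeled points. The estimator at `x` is then the average of the responses
over the estimated ball `S x` of radius `h`. Suppose the estimated metric and the population metric
bound each other up to a factor `a` and an additive error `τ`.

Bias: points of `S x` have population distance at most `a h + τ` from `x`, so their regression
values differ from that at `x` by at most `L (a h + τ)`.

Variance: at `x` it is of order `M² / (n μ(S x))`, where `μ` is the marginal. Cover the support by
population balls of radius `ε` with `2 a ε + τ ≤ h`. Each of them lies in `S x` for every `x` in it,
so `∫ 1 / μ(S x) dμ` is at most the number of balls (`lintegral_inv_measure_le`). With `h` and `ε =
c₁ n^(-1/(2+ξ))` of the same order, both contributions are `O(n^(-2/(2+ξ)))`.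

Metric comparison: `a` must be allowed close to `1`, since `c₁` may be close to its upper bound,
although `α ε(m, σ) ≤ log 2` alone suggests only a fixed factor. The kernel estimate is examined on
a grid of polynomially many points. The variance of `α p̂` is proportional to `α p` with a
coefficient that is a negative power of `m`. So where `α p` is below a threshold `Λ`, a small power
of `m`, the error of `α p̂` is at most a fixed `δ`. Where `α p ≥ Λ`, the estimate is still at least
half as large and both weights are exponentially small, so crossing such a grid cell costs almost
nothing (`measure_not_goodAt_le`, `weightMetric_le_mul_add`). All these cells together give `τ =
O(1/m)`.

The comparison fails with probability at most `1/m` for large `m`, and then the risk is at most `4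
M²`. Admissibility forces `1/m = O(1/n)`, which makes this term negligible too. -/

noncomputable section

namespace DensitySensitive

variable {d : ℕ}

/-! ### Operations on unit-speed curves -/

lemma hasUnitSpeedOn_Icc_iff {f : ℝ → Pt d} {a b : ℝ} :
    HasUnitSpeedOn f (Icc a b) ↔ ∀ x y, a ≤ x → x ≤ y → y ≤ b →
      eVariationOn f (Icc x y) = ENNReal.ofReal (y - x) := by
  unfold HasUnitSpeedOn
  rw [hasConstantSpeedOnWith_iff_ordered]
  constructor
  · intro h x y hax hxy hyb
    have := h ⟨hax, hxy.trans hyb⟩ ⟨hax.trans hxy, hyb⟩ hxy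
    rwa [inter_eq_right.2 (Icc_subset_Icc hax hyb), NNReal.coe_one, one_mul] at this
  · intro h x hx y hy hxy
    rw [inter_eq_right.2 (Icc_subset_Icc hx.1 hy.2), NNReal.coe_one, one_mul]
    exact h x y hx.1 hxy hy.2

lemma hasUnitSpeedOn_comp_add {f : ℝ → Pt d} {a b s : ℝ} (h : HasUnitSpeedOn f (Icc a b)) :
    HasUnitSpeedOn (fun u => f (u + s)) (Icc (a - s) (b - s)) := by
  rw [hasUnitSpeedOn_Icc_iff] at h ⊢
  intro x y hax hxy hyb
  have := eVariationOn.comp_eq_of_monotoneOn f (t := Icc x y) (fun u => u + s)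
    (fun _ _ _ _ huv => by simpa using huv)
  rw [Set.image_add_const_Icc] at this
  rw [show (fun u => f (u + s)) = f ∘ (fun u => u + s) from rfl, this,
    h _ _ (by linarith) (by linarith) (by linarith)]
  ring_nf

lemma IsUnitSpeedCurve.restrict {x y : Pt d} {ℓ s t : ℝ} {γ : ℝ → Pt d}
    (h : IsUnitSpeedCurve x y ℓ γ) (hs : 0 ≤ s) (hst : s ≤ t) (ht : t ≤ ℓ) :
    IsUnitSpeedCurve (γ s) (γ t) (t - s) (fun u => γ (u + s)) where
  length_nonneg := by linarith
  continuousOn := h.continuousOn.comp (by fun_prop)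
    (fun u hu => ⟨by linarith [hu.1], by linarith [hu.2]⟩)
  unit_speed := by
    have h1 : HasUnitSpeedOn γ (Icc s t) := by
      have := h.unit_speed
      rw [hasUnitSpeedOn_Icc_iff] at this ⊢
      exact fun a b ha hab hb => this a b (by linarith) hab (by linarith)
    simpa using hasUnitSpeedOn_comp_add (s := s) h1
  source := by simp
  target := by simp

lemma IsUnitSpeedCurve.reverse {x y : Pt d} {ℓ : ℝ} {γ : ℝ → Pt d}
    (h : IsUnitSpeedCurve x y ℓ γ) : IsUnitSpeedCurve y x ℓ (fun u => γ (ℓ - u)) where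
  length_nonneg := h.length_nonneg
  continuousOn := h.continuousOn.comp (by fun_prop)
    (fun u hu => ⟨by linarith [hu.2], by linarith [hu.1]⟩)
  unit_speed := by
    have h1 := h.unit_speed
    rw [hasUnitSpeedOn_Icc_iff] at h1 ⊢
    intro a b ha hab hb
    have := eVariationOn.comp_eq_of_antitoneOn γ (t := Icc a b) (fun u => ℓ - u)
      (fun _ _ _ _ huv => sub_le_sub_left huv _)
    rw [Set.image_const_sub_Icc] at this
    rw [show (fun u => γ (ℓ - u)) = γ ∘ (fun u => ℓ - u) from rfl, this,
      h1 _ _ (by linarith) (by linarith) (by linarith)]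
    ring_nf
  source := by simp [h.target]
  target := by simp [h.source]

lemma IsUnitSpeedCurve.append {x y z : Pt d} {ℓ₁ ℓ₂ : ℝ} {γ₁ γ₂ : ℝ → Pt d}
    (h₁ : IsUnitSpeedCurve x y ℓ₁ γ₁) (h₂ : IsUnitSpeedCurve y z ℓ₂ γ₂) :
    IsUnitSpeedCurve x z (ℓ₁ + ℓ₂) (fun t => if t ≤ ℓ₁ then γ₁ t else γ₂ (t - ℓ₁)) := by
  have e1 : EqOn (fun t => if t ≤ ℓ₁ then γ₁ t else γ₂ (t - ℓ₁)) γ₁ (Icc 0 ℓ₁) :=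
    fun t ht => by simp [ht.2]
  have e2 : EqOn (fun t => if t ≤ ℓ₁ then γ₁ t else γ₂ (t - ℓ₁)) (fun t => γ₂ (t - ℓ₁))
      (Icc ℓ₁ (ℓ₁ + ℓ₂)) := by
    intro t ht
    by_cases h : t ≤ ℓ₁
    · obtain rfl := le_antisymm h ht.1
      simp [h₁.target, h₂.source]
    · simp [h]
  have n1 := h₁.length_nonneg
  have n2 := h₂.length_nonneg
  refine ⟨add_nonneg n1 n2, ?_, ?_, ?_, ?_⟩
  · rw [← Icc_union_Icc_eq_Icc n1 (by linarith : ℓ₁ ≤ ℓ₁ + ℓ₂)]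
    refine ContinuousOn.union_of_isClosed ?_ ?_ isClosed_Icc isClosed_Icc
    · exact h₁.continuousOn.congr e1
    · exact (h₂.continuousOn.comp (by fun_prop)
        (fun u hu => ⟨by linarith [hu.1], by linarith [hu.2]⟩)).congr e2
  · refine HasUnitSpeedOn.Icc_Icc (y := ℓ₁) ?_ ?_
    · have := h₁.unit_speed
      rw [hasUnitSpeedOn_Icc_iff] at this ⊢
      intro a b ha hab hb
      rw [eVariationOn.eq_of_eqOn (e1.mono (Icc_subset_Icc ha hb)), this a b ha hab hb]
    · have h2 := hasUnitSpeedOn_comp_add (s := -ℓ₁) h₂.unit_speed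
      rw [hasUnitSpeedOn_Icc_iff] at h2 ⊢
      intro a b ha hab hb
      rw [eVariationOn.eq_of_eqOn (e2.mono (Icc_subset_Icc ha hb))]
      simpa [sub_eq_add_neg] using h2 a b (by linarith) hab (by linarith)
  · simp [n1, h₁.source]
  · exact (e2 ⟨by linarith, le_rfl⟩).trans (by simp [h₂.target])

lemma isUnitSpeedCurve_segment (x y : Pt d) :
    IsUnitSpeedCurve x y ‖y - x‖ (fun t => x + (t * ‖y - x‖⁻¹) • (y - x)) := by
  rcases eq_or_ne y x with rfl | hxy
  · refine ⟨norm_nonneg _, by fun_prop, ?_, by simp, by simp⟩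
    rw [hasUnitSpeedOn_Icc_iff]
    intro a b ha hab hb
    simp only [sub_self, norm_zero] at hb
    obtain rfl : a = b := by linarith
    simp
  have hn : 0 < ‖y - x‖ := norm_pos_iff.2 (sub_ne_zero.2 hxy)
  refine ⟨norm_nonneg _, by fun_prop, ?_, by simp, by simp [hn.ne']⟩
  rw [hasUnitSpeedOn_Icc_iff]
  intro a b ha hab hb
  have hed : ∀ s t : ℝ, edist (x + (s * ‖y - x‖⁻¹) • (y - x)) (x + (t * ‖y - x‖⁻¹) • (y - x))
      = edist s t := by
    intro s t
    rw [edist_dist, edist_dist, dist_add_left, dist_eq_norm, ← sub_smul, ← sub_mul, norm_smul,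
      norm_mul, norm_inv, norm_norm, mul_assoc, inv_mul_cancel₀ hn.ne', mul_one, Real.dist_eq,
      Real.norm_eq_abs]
  have h1 : eVariationOn (fun t => x + (t * ‖y - x‖⁻¹) • (y - x)) (Icc a b)
      = eVariationOn (id : ℝ → ℝ) (Icc a b) := by
    simp only [eVariationOn, hed, id]
  rw [h1]
  simp

/-! ### Path metrics with a continuous weight -/

/-- The infimum of `∫ w ∘ γ` over the unit-speed curves `γ` from `x` to `y`. -/
def weightMetric (w : Pt d → ℝ) (x y : Pt d) : ℝ :=
  sInf {c | ∃ (ℓ : ℝ) (γ : ℝ → Pt d), IsUnitSpeedCurve x y ℓ γ ∧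
    c = ∫ t in (0 : ℝ)..ℓ, w (γ t)}

lemma expMetric_eq_weightMetric (α : ℝ) (p : Pt d → ℝ) :
    expMetric α p = weightMetric (fun z => Real.exp (-α * p z)) := rfl

section weight

variable {w : Pt d → ℝ}

lemma IsUnitSpeedCurve.integral_nonneg (hw : ∀ z, 0 ≤ w z) {x y : Pt d} {ℓ : ℝ} {γ : ℝ → Pt d}
    (h : IsUnitSpeedCurve x y ℓ γ) : 0 ≤ ∫ t in (0 : ℝ)..ℓ, w (γ t) :=
  intervalIntegral.integral_nonneg h.length_nonneg fun _ _ => hw _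

lemma weightMetric_le (hw : ∀ z, 0 ≤ w z) {x y : Pt d} {ℓ : ℝ} {γ : ℝ → Pt d}
    (h : IsUnitSpeedCurve x y ℓ γ) : weightMetric w x y ≤ ∫ t in (0 : ℝ)..ℓ, w (γ t) := by
  refine csInf_le ⟨0, ?_⟩ ⟨ℓ, γ, h, rfl⟩
  rintro c ⟨ℓ', γ', h', rfl⟩
  exact h'.integral_nonneg hw

lemma le_weightMetric {x y : Pt d} {b : ℝ}
    (hb : ∀ ℓ γ, IsUnitSpeedCurve x y ℓ γ → b ≤ ∫ t in (0 : ℝ)..ℓ, w (γ t)) :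
    b ≤ weightMetric w x y := by
  -- The straight segment makes the set of costs nonempty, so the default `sInf ∅ = 0` never
  -- intervenes.
  refine le_csInf ⟨_, _, _, isUnitSpeedCurve_segment x y, rfl⟩ ?_
  rintro c ⟨ℓ', γ', h', rfl⟩
  exact hb _ _ h'

lemma weightMetric_nonneg (hw : ∀ z, 0 ≤ w z) (x y : Pt d) : 0 ≤ weightMetric w x y :=
  le_weightMetric fun _ _ h => h.integral_nonneg hw

lemma exists_curve_lt {x y : Pt d} {b : ℝ} (hb : weightMetric w x y < b) :
    ∃ ℓ γ, IsUnitSpeedCurve x y ℓ γ ∧ ∫ t in (0 : ℝ)..ℓ, w (γ t) < b := by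
  by_contra! hcon
  exact absurd (le_weightMetric hcon) (not_le.2 hb)

lemma IsUnitSpeedCurve.intervalIntegrable (hc : Continuous w) {x y : Pt d} {ℓ s t : ℝ}
    {γ : ℝ → Pt d} (h : IsUnitSpeedCurve x y ℓ γ) (hs : 0 ≤ s) (hst : s ≤ t) (ht : t ≤ ℓ) :
    IntervalIntegrable (fun u => w (γ u)) volume s t := by
  apply ContinuousOn.intervalIntegrable
  rw [uIcc_of_le hst]
  exact hc.comp_continuousOn (h.continuousOn.mono (Icc_subset_Icc hs ht))

lemma weightMetric_le_integral (hw : ∀ z, 0 ≤ w z) {x y : Pt d} {ℓ s t : ℝ} {γ : ℝ → Pt d}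
    (h : IsUnitSpeedCurve x y ℓ γ) (hs : 0 ≤ s) (hst : s ≤ t) (ht : t ≤ ℓ) :
    weightMetric w (γ s) (γ t) ≤ ∫ u in s..t, w (γ u) := by
  have := weightMetric_le hw (h.restrict hs hst ht)
  rwa [intervalIntegral.integral_comp_add_right (fun u => w (γ u)), zero_add,
    sub_add_cancel] at this

lemma weightMetric_le_segment (hw : ∀ z, 0 ≤ w z) {x y : Pt d} {b : ℝ}
    (hb : ∀ z ∈ segment ℝ x y, w z ≤ b) : weightMetric w x y ≤ ‖y - x‖ * b := by
  refine (weightMetric_le hw (isUnitSpeedCurve_segment x y)).trans ?_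
  have := intervalIntegral.norm_integral_le_of_norm_le_const (a := 0) (b := ‖y - x‖) (C := b)
    (f := fun t => w (x + (t * ‖y - x‖⁻¹) • (y - x))) ?_
  · rw [sub_zero, abs_of_nonneg (norm_nonneg _), mul_comm] at this
    exact (le_abs_self _).trans this
  · intro t ht
    rw [uIoc_of_le (norm_nonneg _)] at ht
    rw [Real.norm_eq_abs, abs_of_nonneg (hw _)]
    apply hb
    rw [segment_eq_image']
    refine ⟨t * ‖y - x‖⁻¹, ⟨by have := ht.1; positivity, ?_⟩, rfl⟩
    rw [← div_eq_mul_inv]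
    exact div_le_one_of_le₀ ht.2 (norm_nonneg _)

lemma weightMetric_comm (w : Pt d → ℝ) (x y : Pt d) : weightMetric w x y = weightMetric w y x := by
  have key : ∀ (x y : Pt d) (c : ℝ), (∃ (ℓ : ℝ) (γ : ℝ → Pt d), IsUnitSpeedCurve x y ℓ γ ∧
      c = ∫ t in (0 : ℝ)..ℓ, w (γ t)) → (∃ (ℓ : ℝ) (γ : ℝ → Pt d), IsUnitSpeedCurve y x ℓ γ ∧
      c = ∫ t in (0 : ℝ)..ℓ, w (γ t)) := by
    rintro x y c ⟨ℓ, γ, h, rfl⟩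
    refine ⟨ℓ, _, h.reverse, ?_⟩
    rw [intervalIntegral.integral_comp_sub_left (fun u => w (γ u))]
    simp
  unfold weightMetric
  congr 1
  ext c
  exact ⟨key x y c, key y x c⟩

lemma weightMetric_triangle (hc : Continuous w) (hw : ∀ z, 0 ≤ w z) (x y z : Pt d) :
    weightMetric w x z ≤ weightMetric w x y + weightMetric w y z := by
  refine le_of_forall_pos_le_add fun ε hε => ?_
  obtain ⟨ℓ₁, γ₁, h₁, hlt₁⟩ := exists_curve_lt
    (show weightMetric w x y < weightMetric w x y + ε / 2 by linarith)
  obtain ⟨ℓ₂, γ₂, h₂, hlt₂⟩ := exists_curve_lt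
    (show weightMetric w y z < weightMetric w y z + ε / 2 by linarith)
  have h := h₁.append h₂
  have n1 := h₁.length_nonneg
  have n2 := h₂.length_nonneg
  have hle := weightMetric_le hw h
  rw [← intervalIntegral.integral_add_adjacent_intervals
    (h.intervalIntegrable hc le_rfl n1 (by linarith : ℓ₁ ≤ ℓ₁ + ℓ₂))
    (h.intervalIntegrable hc n1 (by linarith : ℓ₁ ≤ ℓ₁ + ℓ₂) le_rfl)] at hle
  have e1 : ∫ t in (0 : ℝ)..ℓ₁, w (if t ≤ ℓ₁ then γ₁ t else γ₂ (t - ℓ₁))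
      = ∫ t in (0 : ℝ)..ℓ₁, w (γ₁ t) := by
    apply intervalIntegral.integral_congr
    intro t ht
    rw [uIcc_of_le n1] at ht
    simp [ht.2]
  have e2 : ∫ t in ℓ₁..(ℓ₁ + ℓ₂), w (if t ≤ ℓ₁ then γ₁ t else γ₂ (t - ℓ₁))
      = ∫ t in (0 : ℝ)..ℓ₂, w (γ₂ t) := by
    rw [show ∫ t in (0 : ℝ)..ℓ₂, w (γ₂ t) = ∫ t in ℓ₁..(ℓ₁ + ℓ₂), w (γ₂ (t - ℓ₁)) by
      rw [intervalIntegral.integral_comp_sub_right (fun u => w (γ₂ u))]; simp]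
    apply intervalIntegral.integral_congr
    intro t ht
    rw [uIcc_of_le (by linarith)] at ht
    by_cases h : t ≤ ℓ₁
    · obtain rfl := le_antisymm h ht.1
      simp [h₁.target, h₂.source]
    · simp [h]
  linarith

lemma weightMetric_le_norm (hw : ∀ z, 0 ≤ w z) (hw1 : ∀ z, w z ≤ 1) (x y : Pt d) :
    weightMetric w x y ≤ ‖y - x‖ := by
  simpa using weightMetric_le_segment hw (x := x) (y := y) (b := 1) fun z _ => hw1 z

/-- With weights at most `1` the metric is dominated by Euclidean distance, so the triangle
inequality makes it Lipschitz in the pair. Continuity provides the measurability of balls, jointly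
in centre and point. -/
lemma continuous_weightMetric (hc : Continuous w) (hw : ∀ z, 0 ≤ w z) (hw1 : ∀ z, w z ≤ 1) :
    Continuous (fun q : Pt d × Pt d => weightMetric w q.1 q.2) := by
  have key : ∀ q q' : Pt d × Pt d,
      weightMetric w q.1 q.2 ≤ weightMetric w q'.1 q'.2 + 2 * dist q q' := by
    intro q q'
    have h1 := weightMetric_triangle hc hw q.1 q'.1 q.2
    have h2 := weightMetric_triangle hc hw q'.1 q'.2 q.2
    have h3 := weightMetric_le_norm hw hw1 q.1 q'.1
    have h4 := weightMetric_le_norm hw hw1 q'.2 q.2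
    rw [← dist_eq_norm] at h3 h4
    rw [dist_comm] at h3
    have h5 : dist q.1 q'.1 ≤ dist q q' := le_max_left _ _
    have h6 : dist q.2 q'.2 ≤ dist q q' := le_max_right _ _
    linarith
  refine (LipschitzWith.of_dist_le_mul (K := 2) fun q q' => ?_).continuous
  rw [Real.dist_eq, abs_le]
  have h1 := key q q'
  have h2 := key q' q
  rw [dist_comm] at h2
  simp only [NNReal.coe_ofNat]
  constructor <;> linarith

end weight

/-! ### Comparison of path metrics up to cheap cells -/

/-- If `v ≤ a w` outside finitely many closed cells, each of `v`-diameter at most `θ`, then the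
metric of `v` is at most `a` times that of `w`, up to `θ` for every cell. -/
lemma weightMetric_le_mul_add {v w : Pt d → ℝ} {a θ : ℝ} (hvc : Continuous v) (hv : ∀ z, 0 ≤ v z)
    (hwc : Continuous w) (hw : ∀ z, 0 ≤ w z) (ha : 0 ≤ a) (hθ : 0 ≤ θ)
    {ι : Type*} (s : Finset ι) (c : ι → Set (Pt d))
    (hclosed : ∀ i ∈ s, IsClosed (c i)) (hdiam : ∀ i ∈ s, ∀ z ∈ c i, ∀ z' ∈ c i,
      weightMetric v z z' ≤ θ) (hgood : ∀ z, v z ≤ a * w z ∨ ∃ i ∈ s, z ∈ c i) (x y : Pt d) :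
    weightMetric v x y ≤ a * weightMetric w x y + s.card * θ := by
  classical
  suffices H : ∀ ℓ γ, IsUnitSpeedCurve x y ℓ γ →
      weightMetric v x y ≤ a * (∫ t in (0 : ℝ)..ℓ, w (γ t)) + s.card * θ by
    refine le_of_forall_pos_le_add fun ε hε => ?_
    obtain ⟨ℓ, γ, h, hlt⟩ := exists_curve_lt
      -- The denominator is `a + 1` because `a = 0` is allowed.
      (show weightMetric w x y < weightMetric w x y + ε / (a + 1) by
        have : 0 < ε / (a + 1) := by positivity
        linarith)
    have h1 := H ℓ γ h
    have h2 : a * (ε / (a + 1)) ≤ ε := by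
      rw [mul_div_assoc', div_le_iff₀ (by positivity)]
      nlinarith
    nlinarith [mul_le_mul_of_nonneg_left hlt.le ha]
  intro ℓ γ h
  have direct : ∀ t₀ t₁, 0 ≤ t₀ → t₀ ≤ t₁ → t₁ ≤ ℓ →
      (∀ t ∈ Ioo t₀ t₁, v (γ t) ≤ a * w (γ t)) →
      weightMetric v (γ t₀) (γ t₁) ≤ a * ∫ t in t₀..t₁, w (γ t) := by
    intro t₀ t₁ h0 h01 h1 hle
    refine (weightMetric_le_integral hv h h0 h01 h1).trans ?_
    rw [← intervalIntegral.integral_const_mul]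
    exact intervalIntegral.integral_mono_on_of_le_Ioo h01 (h.intervalIntegrable hvc h0 h01 h1)
      ((h.intervalIntegrable hwc h0 h01 h1).const_mul a) hle
  -- Induction on the number of cells the curve may still meet. The interval is open at `t₀` because
  -- `t₀` will be the last time spent in a cell already removed.
  have main : ∀ (k : ℕ) (u : Finset ι), u ⊆ s → u.card = k → ∀ t₀, 0 ≤ t₀ → t₀ ≤ ℓ →
      (∀ t ∈ Ioc t₀ ℓ, v (γ t) ≤ a * w (γ t) ∨ ∃ i ∈ u, γ t ∈ c i) →
      weightMetric v (γ t₀) (γ ℓ) ≤ a * (∫ t in t₀..ℓ, w (γ t)) + k * θ := by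
    intro k
    induction k with
    | zero =>
      intro u _ hu t₀ h0 h1 hcov
      rw [Finset.card_eq_zero] at hu
      subst hu
      simpa using direct t₀ ℓ h0 h1 le_rfl fun t ht => by
        simpa using hcov t ⟨ht.1, ht.2.le⟩
    | succ k ih =>
      intro u hus hu t₀ h0 h1 hcov
      have hclosedT : ∀ i ∈ u, IsClosed (Icc t₀ ℓ ∩ γ ⁻¹' c i) := fun i hi =>
        (h.continuousOn.mono (Icc_subset_Icc h0 le_rfl)).preimage_isClosed_of_isClosed
          isClosed_Icc (hclosed i (hus hi))
      by_cases hT : ∃ t ∈ Icc t₀ ℓ, ∃ i ∈ u, γ t ∈ c i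
      · have hTc : IsCompact (⋃ i ∈ u, Icc t₀ ℓ ∩ γ ⁻¹' c i) :=
          isCompact_Icc.of_isClosed_subset (u.finite_toSet.isClosed_biUnion hclosedT)
            (iUnion₂_subset fun i _ => inter_subset_left)
        have hTn : (⋃ i ∈ u, Icc t₀ ℓ ∩ γ ⁻¹' c i).Nonempty := by
          obtain ⟨t, ht, i, hi, hti⟩ := hT
          exact ⟨t, mem_iUnion₂.2 ⟨i, hi, ht, hti⟩⟩
        obtain ⟨t₁, ht₁⟩ := hTc.exists_isLeast hTn
        obtain ⟨i, hi, ht₁I, ht₁c⟩ := mem_iUnion₂.1 ht₁.1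
        -- `t₁` is the first time at which any remaining cell is met and `t₂` the last visit to that
        -- cell `c i`. The curve between them, which may leave the cell and return, is replaced by a
        -- jump of cost at most `θ`. Maximality of `t₂` excludes `c i` afterwards.
        obtain ⟨t₂, ht₂⟩ := (isCompact_Icc.of_isClosed_subset (hclosedT i hi)
          inter_subset_left).exists_isGreatest ⟨t₁, ht₁I, ht₁c⟩
        have h12 : t₁ ≤ t₂ := ht₂.2 ⟨ht₁I, ht₁c⟩
        have a1 := direct t₀ t₁ h0 ht₁I.1 ht₁I.2 fun t ht => by
          rcases hcov t ⟨ht.1, ht.2.le.trans ht₁I.2⟩ with hg | ⟨j, hj, htj⟩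
          · exact hg
          · exact absurd (ht₁.2 (mem_iUnion₂.2 ⟨j, hj, ⟨ht.1.le, ht.2.le.trans ht₁I.2⟩, htj⟩))
              (not_le.2 ht.2)
        have a2 := hdiam i (hus hi) _ ht₁c _ ht₂.1.2
        have a3 := ih (u.erase i) ((Finset.erase_subset _ _).trans hus)
          (by rw [Finset.card_erase_of_mem hi, hu]; simp) t₂ (h0.trans ht₂.1.1.1) ht₂.1.1.2
          fun t ht => by
            rcases hcov t ⟨ht₂.1.1.1.trans_lt ht.1, ht.2⟩ with hg | ⟨j, hj, htj⟩
            · exact Or.inl hg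
            · refine Or.inr ⟨j, Finset.mem_erase.2 ⟨?_, hj⟩, htj⟩
              rintro rfl
              exact absurd (ht₂.2 ⟨⟨ht₂.1.1.1.trans ht.1.le, ht.2⟩, htj⟩) (not_le.2 ht.1)
        have b1 := weightMetric_triangle hvc hv (γ t₀) (γ t₁) (γ ℓ)
        have b2 := weightMetric_triangle hvc hv (γ t₁) (γ t₂) (γ ℓ)
        have i1 := h.intervalIntegrable hwc h0 ht₁I.1 ht₁I.2
        have i2 := h.intervalIntegrable hwc (h0.trans ht₁I.1) h12 ht₂.1.1.2
        have i3 := h.intervalIntegrable hwc (h0.trans ht₂.1.1.1) ht₂.1.1.2 le_rfl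
        have e1 := intervalIntegral.integral_add_adjacent_intervals i1 i2
        have e2 := intervalIntegral.integral_add_adjacent_intervals (i1.trans i2) i3
        have hnn : 0 ≤ ∫ t in t₁..t₂, w (γ t) :=
          intervalIntegral.integral_nonneg h12 fun _ _ => hw _
        rw [← e2, ← e1]
        push_cast
        nlinarith [mul_nonneg ha hnn]
      · push Not at hT
        have a1 := direct t₀ ℓ h0 h1 le_rfl fun t ht => by
          rcases hcov t ⟨ht.1, ht.2.le⟩ with hg | ⟨j, hj, htj⟩
          · exact hg
          · exact absurd htj (hT t ⟨ht.1.le, ht.2.le⟩ j hj)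
        push_cast
        nlinarith
  have := main _ s subset_rfl rfl 0 le_rfl h.length_nonneg fun t _ => hgood (γ t)
  rwa [h.source, h.target] at this

/-! ### Regularity of smoothed densities -/

/-- Quantitative form of the regularity of a smoothing kernel: it is bounded by `b`, Hölder
continuous of exponent `β` with constant `A`, and supported in the ball of radius `R`. -/
structure KernelBounds (d : ℕ) (K : ℝ → ℝ) (b A β R : ℝ) : Prop where
  b_pos : 0 < b
  A_nonneg : 0 ≤ A
  β_pos : 0 < β
  R_nonneg : 0 ≤ R
  nonneg : ∀ x : Pt d, 0 ≤ K ‖x‖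
  le : ∀ x : Pt d, K ‖x‖ ≤ b
  holder : ∀ x y : Pt d, |K ‖x‖ - K ‖y‖| ≤ A * ‖x - y‖ ^ β
  eq_zero : ∀ x : Pt d, R < ‖x‖ → K ‖x‖ = 0
  continuous : Continuous fun x : Pt d => K ‖x‖

lemma IsSmoothingKernel.exists_bounds {K : ℝ → ℝ} (hK : IsSmoothingKernel d K) :
    ∃ b A β R : ℝ, KernelBounds d K b A β R := by
  obtain ⟨A, β, hβ, hA⟩ := hK.holder
  have hcont : Continuous fun x : Pt d => K ‖x‖ := hA.continuous hβ
  obtain ⟨b, hb⟩ := hcont.bounded_above_of_compact_support hK.compact_support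
  obtain ⟨R, hR⟩ := hK.compact_support.isCompact.isBounded.exists_norm_le
  refine ⟨max b 1, A, β, max R 0, by positivity, A.2, hβ, by positivity, hK.nonneg, ?_, ?_, ?_,
    hcont⟩
  · exact fun x => (le_abs_self _).trans ((hb x).trans (le_max_left _ _))
  · intro x y
    have := hA.dist_le x y
    rwa [Real.dist_eq, dist_eq_norm] at this
  · intro x hx
    by_contra hne
    exact absurd (hR x (subset_tsupport _ hne)) (not_le.2 ((le_max_left _ _).trans_lt hx))

/-- The rescaled kernel `σ^{-d} K(‖z - u‖ / σ)`. -/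
def scaledKernel (K : ℝ → ℝ) (σ : ℝ) (z u : Pt d) : ℝ := (σ ^ d)⁻¹ * K (‖z - u‖ / σ)

/-- The empirical distribution of finitely many points. -/
def empirical {m : ℕ} (U : Fin m → Pt d) : Measure (Pt d) :=
  (m : ℝ≥0∞)⁻¹ • ∑ j, Measure.dirac (U j)

lemma isProbabilityMeasure_empirical {m : ℕ} (hm : 0 < m) (U : Fin m → Pt d) :
    IsProbabilityMeasure (empirical U) := by
  constructor
  simp [empirical, ENNReal.inv_mul_cancel (Nat.cast_ne_zero.2 hm.ne') (ENNReal.natCast_ne_top m)]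

/-- This puts the estimate and its target on the same footing: every bound for smoothed densities
applies to both, and the metric comparison can be used in both directions. -/
lemma kde_eq_smoothedDensity {m : ℕ} (K : ℝ → ℝ) (σ : ℝ) (U : Fin m → Pt d) :
    kde K σ U = smoothedDensity K σ (empirical U) := by
  funext z
  rw [kde, smoothedDensity, empirical, integral_smul_measure, integral_finsetSum_measure]
  · simp
  · intro j _
    exact integrable_dirac enorm_lt_top

lemma ae_empirical {m : ℕ} {U : Fin m → Pt d} {s : Set (Pt d)} (h : ∀ j, U j ∈ s) :
    ∀ᵐ u ∂(empirical U), u ∈ s := by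
  refine Measure.ae_smul_measure ?_ _
  rw [ae_iff, Measure.finsetSum_apply]
  refine Finset.sum_eq_zero fun j _ => ?_
  rw [← ae_iff, ae_dirac_eq]
  exact h j

section scaled

variable {K : ℝ → ℝ} {b A β R σ : ℝ}

lemma scaledKernel_eq (hσ : 0 < σ) (z u : Pt d) :
    scaledKernel K σ z u = (σ ^ d)⁻¹ * K ‖σ⁻¹ • (z - u)‖ := by
  rw [scaledKernel, norm_smul, norm_inv, Real.norm_eq_abs, abs_of_pos hσ, div_eq_inv_mul]

lemma KernelBounds.scaled_nonneg (hK : KernelBounds d K b A β R) (hσ : 0 < σ) (z u : Pt d) :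
    0 ≤ scaledKernel K σ z u := by
  rw [scaledKernel_eq hσ]
  exact mul_nonneg (by positivity) (hK.nonneg _)

lemma KernelBounds.scaled_le (hK : KernelBounds d K b A β R) (hσ : 0 < σ) (z u : Pt d) :
    scaledKernel K σ z u ≤ b / σ ^ d := by
  rw [scaledKernel_eq hσ, div_eq_inv_mul]
  exact mul_le_mul_of_nonneg_left (hK.le _) (by positivity)

lemma KernelBounds.scaled_holder (hK : KernelBounds d K b A β R) (hσ : 0 < σ) (z z' u : Pt d) :
    |scaledKernel K σ z u - scaledKernel K σ z' u| ≤ A * (‖z - z'‖ / σ) ^ β / σ ^ d := by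
  rw [scaledKernel_eq hσ, scaledKernel_eq hσ, ← mul_sub, abs_mul, abs_of_pos (by positivity),
    div_eq_inv_mul]
  refine mul_le_mul_of_nonneg_left ((hK.holder _ _).trans_eq ?_) (by positivity)
  rw [← smul_sub, sub_sub_sub_cancel_right, norm_smul, norm_inv, Real.norm_eq_abs, abs_of_pos hσ,
    div_eq_inv_mul]

lemma KernelBounds.scaled_eq_zero (hK : KernelBounds d K b A β R) (hσ : 0 < σ) {z u : Pt d}
    (h : R * σ < ‖z - u‖) : scaledKernel K σ z u = 0 := by
  rw [scaledKernel_eq hσ, hK.eq_zero, mul_zero]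
  rw [norm_smul, norm_inv, Real.norm_eq_abs, abs_of_pos hσ, ← div_eq_inv_mul, lt_div_iff₀ hσ]
  exact h

lemma KernelBounds.scaled_continuous (hK : KernelBounds d K b A β R) (hσ : 0 < σ) :
    Continuous fun q : Pt d × Pt d => scaledKernel K σ q.1 q.2 := by
  simp_rw [scaledKernel_eq hσ]
  exact continuous_const.mul (hK.continuous.comp (by fun_prop))

lemma KernelBounds.scaled_integrable (hK : KernelBounds d K b A β R) (hσ : 0 < σ)
    (μ : Measure (Pt d)) [IsProbabilityMeasure μ] (z : Pt d) :
    Integrable (scaledKernel K σ z) μ := by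
  refine Integrable.of_bound (C := b / σ ^ d) ?_ ?_
  · exact ((hK.scaled_continuous hσ).comp (by fun_prop : Continuous fun u : Pt d => (z, u)))
      |>.aestronglyMeasurable
  · refine ae_of_all _ fun u => ?_
    rw [Real.norm_eq_abs, abs_of_nonneg (hK.scaled_nonneg hσ z u)]
    exact hK.scaled_le hσ z u

variable (μ : Measure (Pt d))

lemma smoothedDensity_eq (K : ℝ → ℝ) (σ : ℝ) (μ : Measure (Pt d)) (z : Pt d) :
    smoothedDensity K σ μ z = ∫ u, scaledKernel K σ z u ∂μ := rfl

lemma KernelBounds.density_nonneg (hK : KernelBounds d K b A β R) (hσ : 0 < σ) (z : Pt d) :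
    0 ≤ smoothedDensity K σ μ z :=
  integral_nonneg fun u => hK.scaled_nonneg hσ z u

lemma KernelBounds.density_eq_zero (hK : KernelBounds d K b A β R) (hσ : 0 < σ)
    (hμ : ∀ᵐ u ∂μ, u ∈ cube d) {z : Pt d} {i : Fin d} (hz : 1 + R * σ < |z i|) :
    smoothedDensity K σ μ z = 0 := by
  rw [smoothedDensity_eq]
  refine integral_eq_zero_of_ae ?_
  filter_upwards [hμ] with u hu
  refine hK.scaled_eq_zero hσ ?_
  have h1 : |(z - u) i| ≤ ‖z - u‖ := by simpa using PiLp.norm_apply_le (z - u) i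
  have h2 : |z i| ≤ |(z - u) i| + |u i| := by
    simpa using abs_add_le ((z - u) i) (u i)
  have h3 : |u i| ≤ 1 := abs_le.2 ⟨by linarith [(hu i).1], (hu i).2⟩
  linarith

variable [IsProbabilityMeasure μ]

lemma KernelBounds.density_holder (hK : KernelBounds d K b A β R) (hσ : 0 < σ) (z z' : Pt d) :
    |smoothedDensity K σ μ z - smoothedDensity K σ μ z'| ≤ A * (‖z - z'‖ / σ) ^ β / σ ^ d := by
  rw [smoothedDensity_eq, smoothedDensity_eq, ← integral_sub (hK.scaled_integrable hσ μ z)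
    (hK.scaled_integrable hσ μ z')]
  have := norm_integral_le_of_norm_le_const (μ := μ) (C := A * (‖z - z'‖ / σ) ^ β / σ ^ d)
    (f := fun u => scaledKernel K σ z u - scaledKernel K σ z' u)
    (ae_of_all _ fun u => hK.scaled_holder hσ z z' u)
  simpa using this

lemma KernelBounds.density_continuous (hK : KernelBounds d K b A β R) (hσ : 0 < σ) :
    Continuous (smoothedDensity K σ μ) := by
  rw [continuous_iff_continuousAt]
  intro z
  rw [ContinuousAt, tendsto_iff_norm_sub_tendsto_zero]
  refine squeeze_zero (fun _ => norm_nonneg _) (fun z' => hK.density_holder μ hσ z' z) ?_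
  have hβ := hK.β_pos
  have : Continuous fun z' : Pt d => A * (‖z' - z‖ / σ) ^ β / σ ^ d :=
    (continuous_const.mul (Continuous.rpow_const (by fun_prop) fun _ => Or.inr hβ.le)).div_const _
  have h0 := this.tendsto z
  simpa [Real.zero_rpow hβ.ne'] using h0

end scaled

/-! ### Grids in a box -/

/-- The points of a regular grid in the box `[-R, R]^d`. -/
def gridPoint (R : ℝ) {k : ℕ} (v : Fin d → Fin k) : Pt d :=
  WithLp.toLp 2 fun i => -R + 2 * R * (v i : ℕ) / k

lemma exists_gridPoint {R : ℝ} (hR : 0 < R) {k : ℕ} (hk : 0 < k) {z : Pt d}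
    (hz : ∀ i, |z i| ≤ R) : ∃ v : Fin d → Fin k, ‖z - gridPoint R v‖ ≤ d * (2 * R / k) := by
  have hk' : (0 : ℝ) < k := by exact_mod_cast hk
  have key : ∀ i, ∃ j : Fin k, |z i - (-R + 2 * R * (j : ℕ) / k)| ≤ 2 * R / k := by
    intro i
    obtain ⟨hz1, hz2⟩ := abs_le.1 (hz i)
    set s := (z i + R) * k / (2 * R) with hs
    have hs0 : 0 ≤ s := by have : 0 ≤ z i + R := by linarith
                           positivity
    have hzs : z i = -R + 2 * R * s / k := by rw [hs]; field_simp; ring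
    have hsk : s ≤ k := by
      rw [hs, div_le_iff₀ (by positivity)]; nlinarith
    have main : ∃ j : Fin k, |s - (j : ℕ)| ≤ 1 := by
      by_cases hlt : ⌊s⌋₊ < k
      · refine ⟨⟨⌊s⌋₊, hlt⟩, ?_⟩
        have h1 := Nat.floor_le hs0
        have h2 := Nat.lt_floor_add_one s
        rw [abs_le]; constructor <;> simp only <;> linarith
      -- Only the right end `z i = R` arrives here: the grid has `k` points per axis and omits `R`
      -- itself.
      · refine ⟨⟨k - 1, by omega⟩, ?_⟩
        have h1 := Nat.floor_le hs0
        have h2 : (k : ℝ) ≤ ⌊s⌋₊ := by exact_mod_cast not_lt.1 hlt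
        have h3 : ((k - 1 : ℕ) : ℝ) = k - 1 := by rw [Nat.cast_sub hk]; simp
        rw [abs_le]; constructor <;> simp only [h3] <;> linarith
    obtain ⟨j, hj⟩ := main
    refine ⟨j, ?_⟩
    rw [hzs, show -R + 2 * R * s / k - (-R + 2 * R * (j : ℕ) / k) = (2 * R / k) * (s - (j : ℕ)) by
      ring, abs_mul, abs_of_pos (by positivity)]
    exact mul_le_of_le_one_right (by positivity) hj
  choose v hv using key
  refine ⟨v, ?_⟩
  rw [EuclideanSpace.norm_eq, Real.sqrt_le_left (by positivity)]
  calc ∑ i, ‖(z - gridPoint R v) i‖ ^ 2 ≤ ∑ _i : Fin d, (2 * R / k) ^ 2 := by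
        refine Finset.sum_le_sum fun i _ => ?_
        have := hv i
        rw [Real.norm_eq_abs]
        exact pow_le_pow_left₀ (abs_nonneg _) (by simpa [gridPoint] using this) 2
    _ = d * (2 * R / k) ^ 2 := by simp
    _ ≤ (d * (2 * R / k)) ^ 2 := by
        rw [mul_pow]
        refine mul_le_mul_of_nonneg_right ?_ (by positivity)
        exact_mod_cast Nat.le_self_pow (by norm_num) d

/-! ### Concentration of the kernel estimate at one point -/

section chernoff

variable {Ω : Type*} [MeasurableSpace Ω] {μ : Measure Ω} [IsProbabilityMeasure μ] {ξ : Ω → ℝ}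
  {B : ℝ}

/-- From `exp x ≤ 1 + x + x²` for `|x| ≤ 1` and `ξ² ≤ B ξ`. The variance proxy `B ∫ ξ`, rather than
`B²`, is what makes the deviations small where the density is moderate. -/
lemma integral_exp_centered_le (hξ : Measurable ξ) (h0 : ∀ u, 0 ≤ ξ u) (hB : ∀ u, ξ u ≤ B)
    {t : ℝ} (ht : |t| * B ≤ 1) :
    ∫ u, Real.exp (t * (ξ u - ∫ v, ξ v ∂μ)) ∂μ ≤ Real.exp (t ^ 2 * B * ∫ v, ξ v ∂μ) := by
  have hi : Integrable ξ μ := Integrable.of_bound (C := B) hξ.aestronglyMeasurable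
    (ae_of_all _ fun u => by rw [Real.norm_eq_abs, abs_of_nonneg (h0 u)]; exact hB u)
  set p := ∫ v, ξ v ∂μ with hp
  have hpt : ∀ u, Real.exp (t * ξ u) ≤ 1 + (t + t ^ 2 * B) * ξ u := by
    intro u
    have h1 : |t * ξ u| ≤ 1 := by
      rw [abs_mul, abs_of_nonneg (h0 u)]
      exact (mul_le_mul_of_nonneg_left (hB u) (abs_nonneg t)).trans ht
    have h2 := (abs_le.1 (Real.abs_exp_sub_one_sub_id_le h1)).2
    have h3 : ξ u ^ 2 ≤ B * ξ u := by rw [sq]; exact mul_le_mul_of_nonneg_right (hB u) (h0 u)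
    nlinarith [mul_le_mul_of_nonneg_left h3 (sq_nonneg t)]
  have hint : Integrable (fun u => 1 + (t + t ^ 2 * B) * ξ u) μ :=
    (integrable_const 1).add (hi.const_mul _)
  have h4 : ∫ u, Real.exp (t * ξ u) ∂μ ≤ 1 + (t + t ^ 2 * B) * p := by
    refine (integral_mono_of_nonneg (ae_of_all _ fun u => (Real.exp_pos _).le) hint
      (ae_of_all _ hpt)).trans_eq ?_
    rw [integral_add (integrable_const 1) (hi.const_mul _), integral_const_mul]
    simp [hp]
  have h5 : ∫ u, Real.exp (t * ξ u) ∂μ ≤ Real.exp ((t + t ^ 2 * B) * p) :=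
    h4.trans (by linarith [Real.add_one_le_exp ((t + t ^ 2 * B) * p)])
  have h6 : ∀ u, Real.exp (t * (ξ u - p)) = Real.exp (t * ξ u) * Real.exp (-(t * p)) := by
    intro u
    rw [← Real.exp_add]; ring_nf
  simp_rw [h6]
  rw [integral_mul_const]
  refine (mul_le_mul_of_nonneg_right h5 (Real.exp_pos _).le).trans_eq ?_
  rw [← Real.exp_add]; ring_nf

/-- Chernoff's bound with parameter `t = s α / m` for each sample. By independence the exponents add
up to `m t² B ∫ ξ = s² (α B / m) (α ∫ ξ)`. -/
lemma measure_mean_deviation_le (hξ : Measurable ξ) (h0 : ∀ u, 0 ≤ ξ u) (hB : ∀ u, ξ u ≤ B)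
    {m : ℕ} (hm : 0 < m) {α s c : ℝ} (hα : 0 ≤ α) (hs : |s| * (α * B / m) ≤ 1) :
    Measure.pi (fun _ : Fin m => μ)
        {U | c ≤ s * (α * ((1 / (m : ℝ)) * ∑ j, ξ (U j) - ∫ v, ξ v ∂μ))}
      ≤ ENNReal.ofReal (Real.exp (-c + s ^ 2 * (α * B / m) * (α * ∫ v, ξ v ∂μ))) := by
  set p := ∫ v, ξ v ∂μ with hp
  have hm' : (0 : ℝ) < m := by exact_mod_cast hm
  set t := s * α / m with ht
  have hX : ∀ U : Fin m → Ω, s * (α * ((1 / (m : ℝ)) * ∑ j, ξ (U j) - p))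
      = ∑ j, t * (ξ (U j) - p) := by
    intro U
    rw [← Finset.mul_sum, Finset.sum_sub_distrib, ht]
    simp only [Finset.sum_const, Finset.card_univ, Fintype.card_fin, nsmul_eq_mul]
    field_simp
  have hexp : ∀ U : Fin m → Ω, Real.exp (1 * (s * (α * ((1 / (m : ℝ)) * ∑ j, ξ (U j) - p))))
      = ∏ j, Real.exp (t * (ξ (U j) - p)) := by
    intro U
    rw [one_mul, hX, Real.exp_sum]
  have htB : |t| * B ≤ 1 := by
    refine le_trans (le_of_eq ?_) hs
    rw [ht, abs_div, abs_mul, abs_of_nonneg hα, abs_of_pos hm']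
    ring
  have hint1 : Integrable (fun u => Real.exp (t * (ξ u - p))) μ := by
    refine Integrable.of_bound (C := Real.exp (1 - t * p)) (by fun_prop) (ae_of_all _ fun u => ?_)
    rw [Real.norm_eq_abs, abs_of_pos (Real.exp_pos _)]
    refine Real.exp_le_exp.2 ?_
    have : t * ξ u ≤ |t| * B := by
      refine (le_abs_self _).trans ?_
      rw [abs_mul, abs_of_nonneg (h0 u)]
      exact mul_le_mul_of_nonneg_left (hB u) (abs_nonneg t)
    linarith
  have h1 := measure_ge_le_exp_mul_mgf (μ := Measure.pi (fun _ : Fin m => μ))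
    (X := fun U => s * (α * ((1 / (m : ℝ)) * ∑ j, ξ (U j) - p))) (t := 1) c zero_le_one (by
      simp_rw [hexp]
      exact Integrable.fintype_prod (f := fun _ u => Real.exp (t * (ξ u - p))) fun _ => hint1)
  rw [mgf] at h1
  simp_rw [hexp] at h1
  rw [integral_fintype_prod_eq_pow (fun u => Real.exp (t * (ξ u - p)))] at h1
  have h2 := pow_le_pow_left₀ (integral_nonneg fun u => (Real.exp_pos (t * (ξ u - p))).le)
    (integral_exp_centered_le hξ h0 hB htB) m
  rw [← ofReal_measureReal]
  refine ENNReal.ofReal_le_ofReal (h1.trans ?_)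
  simp only [Fintype.card_fin]
  refine (mul_le_mul_of_nonneg_left h2 (Real.exp_pos _).le).trans_eq ?_
  rw [← Real.exp_nat_mul, ← Real.exp_add, ← hp, ht]
  congr 1
  field_simp

end chernoff

/-- The estimate `q` of a value `p` is accurate at precision `δ` if `αp < Λ`, and is of order at
least `Λ` if `αp ≥ Λ`. -/
def GoodAt (α δ Λ p q : ℝ) : Prop :=
  (α * p < Λ → |α * (q - p)| ≤ δ) ∧ (Λ ≤ α * p → Λ / 2 ≤ α * q)

/-- Write `κ = α b / (σ^d m)`. If `α p < Λ`, both tails at level `δ` have exponent `-s δ + s² κ α p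
≤ -s δ / 2`. If `α p ≥ Λ`, only the lower tail at level `α p / 2` matters; its exponent is at most
`-s α p / 4 ≤ -s δ / 2`, as `s κ ≤ 1/4` and `α p ≥ 2 δ`. -/
lemma measure_not_goodAt_le {K : ℝ → ℝ} {b A β R σ : ℝ} (hK : KernelBounds d K b A β R)
    (hσ : 0 < σ) (μ : Measure (Pt d)) [IsProbabilityMeasure μ] {m : ℕ} (hm : 0 < m)
    {α δ Λ s : ℝ} (hα : 0 ≤ α) (hs : 0 ≤ s) (hsκ : s * (α * (b / σ ^ d) / m) ≤ 1 / 4)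
    (hsΛ : s * (α * (b / σ ^ d) / m) * Λ ≤ δ / 2) (hΛ : 2 * δ ≤ Λ) (z : Pt d) :
    Measure.pi (fun _ : Fin m => μ)
        {U | ¬ GoodAt α δ Λ (smoothedDensity K σ μ z) (kde K σ U z)}
      ≤ ENNReal.ofReal (2 * Real.exp (-(s * δ / 2))) := by
  set p := smoothedDensity K σ μ z with hp
  set κ := α * (b / σ ^ d) / m with hκ
  have hκ0 : 0 ≤ κ := by have := hK.b_pos; positivity
  have hp0 : 0 ≤ p := hK.density_nonneg μ hσ z
  have hdev : ∀ (s' c : ℝ), |s'| = s →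
      Measure.pi (fun _ : Fin m => μ) {U | c ≤ s' * (α * (kde K σ U z - p))}
        ≤ ENNReal.ofReal (Real.exp (-c + s ^ 2 * κ * (α * p))) := by
    intro s' c hs'
    have := measure_mean_deviation_le (μ := μ) (ξ := scaledKernel K σ z) (B := b / σ ^ d)
      ((hK.scaled_continuous hσ).comp (by fun_prop : Continuous fun u : Pt d => (z, u))).measurable
      (hK.scaled_nonneg hσ z) (hK.scaled_le hσ z) hm (α := α) (s := s') (c := c) hα
      (by rw [hs']; linarith)
    rw [← sq_abs s', hs'] at this
    exact this
  have h1 := hdev s (s * δ) (abs_of_nonneg hs)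
  have h2 := hdev (-s) (s * δ) (by rw [abs_neg, abs_of_nonneg hs])
  have h3 := hdev (-s) (s * (α * p / 2)) (by rw [abs_neg, abs_of_nonneg hs])
  rcases lt_or_ge (α * p) Λ with hlt | hge
  · have hexp : -(s * δ) + s ^ 2 * κ * (α * p) ≤ -(s * δ / 2) := by
      have : s ^ 2 * κ * (α * p) ≤ s * (δ / 2) := by
        rw [sq, mul_assoc, mul_assoc, ← mul_assoc s κ]
        refine mul_le_mul_of_nonneg_left (le_trans ?_ hsΛ) hs
        exact mul_le_mul_of_nonneg_left hlt.le (by positivity)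
      linarith
    have hb := ENNReal.ofReal_le_ofReal (Real.exp_le_exp.2 hexp)
    refine (measure_mono (t := {U | s * δ ≤ s * (α * (kde K σ U z - p))} ∪
      {U | s * δ ≤ -s * (α * (kde K σ U z - p))}) ?_).trans ((measure_union_le _ _).trans
        ((add_le_add (h1.trans hb) (h2.trans hb)).trans_eq ?_))
    · intro U hU
      by_contra hcon
      simp only [mem_union, mem_ofPred_eq, not_or, not_le] at hcon
      refine hU ⟨fun _ => ?_, fun h => absurd h (not_le.2 hlt)⟩
      rcases hs.eq_or_lt with rfl | hspos
      · simp at hcon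
      rw [abs_le]
      have c1 := lt_of_mul_lt_mul_left hcon.1 hs
      have c2 : s * (-(α * (kde K σ U z - p))) < s * δ := by linarith [hcon.2]
      have c3 := lt_of_mul_lt_mul_left c2 hs
      constructor <;> linarith
    · rw [← ENNReal.ofReal_add (Real.exp_pos _).le (Real.exp_pos _).le, two_mul]
  · have hexp : -(s * (α * p / 2)) + s ^ 2 * κ * (α * p) ≤ -(s * δ / 2) := by
      have a1 : s * (s * κ) * (α * p) ≤ s * (1 / 4) * (α * p) :=
        mul_le_mul_of_nonneg_right (mul_le_mul_of_nonneg_left hsκ hs) (by positivity)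
      have a2 : s * (2 * δ) ≤ s * (α * p) := mul_le_mul_of_nonneg_left (hΛ.trans hge) hs
      nlinarith
    refine (measure_mono (t := {U | s * (α * p / 2) ≤ -s * (α * (kde K σ U z - p))}) ?_).trans
      ((h3.trans (ENNReal.ofReal_le_ofReal (Real.exp_le_exp.2 hexp))).trans
        (ENNReal.ofReal_le_ofReal (by linarith [Real.exp_pos (-(s * δ / 2))])))
    intro U hU
    have hU' : α * kde K σ U z < Λ / 2 := by
      by_contra hcon
      exact hU ⟨fun h => absurd h (not_lt.2 hge), fun _ => not_lt.1 hcon⟩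
    change s * (α * p / 2) ≤ -s * (α * (kde K σ U z - p))
    rw [neg_mul, ← mul_neg]
    refine mul_le_mul_of_nonneg_left ?_ hs
    rw [mul_sub]
    linarith

/-! ### From grid values to exponential metrics -/

section expweight

variable {α : ℝ} {p : Pt d → ℝ}

lemma exp_weight_nonneg (α : ℝ) (p : Pt d → ℝ) (z : Pt d) : 0 ≤ Real.exp (-α * p z) :=
  (Real.exp_pos _).le

lemma exp_weight_le_one (hα : 0 ≤ α) (hp : ∀ z, 0 ≤ p z) (z : Pt d) :
    Real.exp (-α * p z) ≤ 1 := by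
  rw [Real.exp_le_one_iff, neg_mul, neg_nonpos]
  exact mul_nonneg hα (hp z)

lemma exp_weight_continuous (hp : Continuous p) : Continuous fun z => Real.exp (-α * p z) := by
  fun_prop

end expweight

/-- The values `p` and `q` are either `δ`-close after multiplication by `α`, or both large. -/
def Comparable (α δ Λ p q : ℝ) : Prop :=
  |α * (q - p)| ≤ δ ∨ (Λ / 2 ≤ α * p ∧ Λ / 2 ≤ α * q)

lemma Comparable.symm {α δ Λ p q : ℝ} (h : Comparable α δ Λ p q) : Comparable α δ Λ q p := by
  rcases h with h | h
  · refine Or.inl ?_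
    rwa [← abs_neg, ← mul_neg, neg_sub]
  · exact Or.inr h.symm

lemma GoodAt.comparable {α δ Λ p q : ℝ} (hΛ : 0 ≤ Λ) (h : GoodAt α δ Λ p q) :
    Comparable α δ Λ p q := by
  rcases lt_or_ge (α * p) Λ with hlt | hge
  · exact Or.inl (h.1 hlt)
  · exact Or.inr ⟨by linarith, h.2 hge⟩

/-- Comparability of two smoothed densities on a fine grid implies comparability of the
corresponding exponential metrics. -/
lemma expMetric_le_of_comparable {K : ℝ → ℝ} {b A β R σ : ℝ} (hK : KernelBounds d K b A β R)
    (hσ : 0 < σ) {μ ν : Measure (Pt d)} [IsProbabilityMeasure μ] [IsProbabilityMeasure ν]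
    (hμ : ∀ᵐ u ∂μ, u ∈ cube d) (hν : ∀ᵐ u ∂ν, u ∈ cube d) {α δ Λ Rb r : ℝ} {k : ℕ}
    (hα : 0 ≤ α) (hδ : 0 ≤ δ) (hRb : 1 + R * σ ≤ Rb) (hk : 0 < k) (hr : r = d * (2 * Rb / k))
    (hhol : α * (A * (r / σ) ^ β / σ ^ d) ≤ δ)
    (hcmp : ∀ v : Fin d → Fin k, Comparable α δ Λ (smoothedDensity K σ μ (gridPoint Rb v))
      (smoothedDensity K σ ν (gridPoint Rb v))) (x y : Pt d) :
    expMetric α (smoothedDensity K σ ν) x y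
      ≤ Real.exp (3 * δ) * expMetric α (smoothedDensity K σ μ) x y
        + (k : ℝ) ^ d * (2 * r * Real.exp (δ - Λ / 2)) := by
  classical
  have hRb0 : 0 < Rb := by have := mul_nonneg hK.R_nonneg hσ.le; linarith
  have hr0 : 0 ≤ r := by rw [hr]; positivity
  have hβ := hK.β_pos
  have hA := hK.A_nonneg
  have hloc : ∀ (η : Measure (Pt d)) [IsProbabilityMeasure η] (z g : Pt d), ‖z - g‖ ≤ r →
      |α * smoothedDensity K σ η z - α * smoothedDensity K σ η g| ≤ δ := by
    intro η _ z g hzg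
    rw [← mul_sub, abs_mul, abs_of_nonneg hα]
    refine le_trans (mul_le_mul_of_nonneg_left ((hK.density_holder η hσ z g).trans ?_) hα) hhol
    gcongr
  -- The cheap cells: in the ball of radius `r` about such a grid point the weight of `ν` is at most
  -- `exp (δ - Λ / 2)`, so a segment between two of its points costs at most `2 r` times that.
  set s : Finset (Fin d → Fin k) := Finset.univ.filter fun v =>
    Λ / 2 ≤ α * smoothedDensity K σ ν (gridPoint Rb v) with hs
  have hcard : (s.card : ℝ) ≤ (k : ℝ) ^ d := by
    have := Finset.card_le_univ s
    simp only [Fintype.card_pi, Fintype.card_fin, Finset.prod_const, Finset.card_univ] at this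
    exact_mod_cast this
  have hθ : 0 ≤ 2 * r * Real.exp (δ - Λ / 2) := by positivity
  rw [expMetric_eq_weightMetric, expMetric_eq_weightMetric]
  refine (weightMetric_le_mul_add (exp_weight_continuous (hK.density_continuous ν hσ))
    (exp_weight_nonneg _ _) (exp_weight_continuous (hK.density_continuous μ hσ))
    (exp_weight_nonneg _ _) (Real.exp_pos (3 * δ)).le hθ s
    (fun v => Metric.closedBall (gridPoint Rb v) r) (fun _ _ => Metric.isClosed_closedBall)
    ?_ ?_ x y).trans (add_le_add_right (mul_le_mul_of_nonneg_right hcard hθ) _)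
  · intro v hv z hz z' hz'
    have hv' := (Finset.mem_filter.1 hv).2
    refine (weightMetric_le_segment (exp_weight_nonneg _ _) (b := Real.exp (δ - Λ / 2))
      fun u hu => ?_).trans ?_
    · have hu' := (convex_closedBall (gridPoint Rb v) r).segment_subset hz hz' hu
      rw [mem_closedBall_iff_norm] at hu'
      have := abs_le.1 (hloc ν u _ hu')
      exact Real.exp_le_exp.2 (by linarith [this.1])
    · refine mul_le_mul_of_nonneg_right ?_ (Real.exp_pos _).le
      rw [← dist_eq_norm]
      have h1 := dist_triangle_right z' z (gridPoint Rb v)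
      rw [Metric.mem_closedBall] at hz hz'
      linarith
  · intro z
    by_cases hz : ∀ i, |z i| ≤ Rb
    · obtain ⟨v, hv⟩ := exists_gridPoint hRb0 hk hz
      rw [← hr] at hv
      rcases hcmp v with h | h
      -- The exponent `3 δ` is `δ` at the grid point plus `δ` for moving each of the two densities
      -- from there to `z`.
      · refine Or.inl ?_
        rw [← Real.exp_add]
        refine Real.exp_le_exp.2 ?_
        have h1 := abs_le.1 (hloc ν z _ hv)
        have h2 := abs_le.1 (hloc μ z _ hv)
        have h3 := abs_le.1 h
        linarith [h1.1, h2.2, h3.1]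
      · exact Or.inr ⟨v, Finset.mem_filter.2 ⟨Finset.mem_univ _, h.2⟩,
          mem_closedBall_iff_norm.2 hv⟩
    -- Outside the box both densities vanish and both weights equal `1`.
    · push Not at hz
      obtain ⟨i, hi⟩ := hz
      refine Or.inl ?_
      rw [hK.density_eq_zero μ hσ hμ (hRb.trans_lt hi), hK.density_eq_zero ν hσ hν (hRb.trans_lt hi)]
      simp only [mul_zero, Real.exp_zero, mul_one]
      exact Real.one_le_exp (by positivity)

/-! ### Bias and variance of local averages -/

lemma integral_sq_sum_sub_le {Ω : Type*} [MeasurableSpace Ω] {μ : Measure Ω}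
    [IsProbabilityMeasure μ] {φ : Ω → ℝ} (hφ : MemLp φ 2 μ) (n : ℕ) :
    Integrable (fun Z : Fin n → Ω => (∑ i, φ (Z i) - n * ∫ u, φ u ∂μ) ^ 2)
        (Measure.pi fun _ : Fin n => μ) ∧
      ∫ Z : Fin n → Ω, (∑ i, φ (Z i) - n * ∫ u, φ u ∂μ) ^ 2 ∂(Measure.pi fun _ : Fin n => μ)
        ≤ n * ∫ u, φ u ^ 2 ∂μ := by
  have hmp : ∀ i : Fin n, MeasurePreserving (fun Z : Fin n → Ω => Z i)
      (Measure.pi fun _ : Fin n => μ) μ := fun i => measurePreserving_eval _ i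
  have hL : ∀ i : Fin n, MemLp (fun Z : Fin n → Ω => φ (Z i)) 2 (Measure.pi fun _ : Fin n => μ) :=
    fun i => hφ.comp_measurePreserving (hmp i)
  have hsum : MemLp (fun Z : Fin n → Ω => ∑ i, φ (Z i)) 2 (Measure.pi fun _ : Fin n => μ) :=
    memLp_finsetSum _ fun i _ => hL i
  have hmean : ∫ Z : Fin n → Ω, ∑ i, φ (Z i) ∂(Measure.pi fun _ : Fin n => μ)
      = n * ∫ u, φ u ∂μ := by
    rw [integral_finsetSum _ fun i _ => (hL i).integrable (by norm_num)]
    have : ∀ i : Fin n, ∫ Z : Fin n → Ω, φ (Z i) ∂(Measure.pi fun _ : Fin n => μ)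
        = ∫ u, φ u ∂μ := by
      intro i
      conv_rhs => rw [← (hmp i).map_eq]
      rw [integral_map (hmp i).measurable.aemeasurable]
      rw [(hmp i).map_eq]
      exact hφ.aestronglyMeasurable
    simp [this]
  constructor
  · exact (hsum.sub (memLp_const (n * ∫ u, φ u ∂μ))).integrable_sq
  · have hvar := variance_sum_pi (μ := fun _ : Fin n => μ) (X := fun _ => φ) fun _ => hφ
    rw [show (∑ i : Fin n, fun ω : Fin n → Ω => φ (ω i)) = fun Z => ∑ i, φ (Z i) by
      ext; simp, variance_eq_integral hsum.aestronglyMeasurable.aemeasurable, hmean] at hvar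
    rw [hvar]
    simp only [Finset.sum_const, Finset.card_univ, Fintype.card_fin, nsmul_eq_mul]
    exact mul_le_mul_of_nonneg_left (variance_le_expectation_sq hφ.aestronglyMeasurable)
      (Nat.cast_nonneg n)

lemma integral_const_add_div {Ω : Type*} [MeasurableSpace Ω] {μ : Measure Ω}
    [IsProbabilityMeasure μ] {F G : Ω → ℝ} (hF : Integrable F μ) (hG : Integrable G μ)
    (c a b k : ℝ) :
    ∫ u, (c + (a * F u + b * G u) / k) ∂μ = c + (a * ∫ u, F u ∂μ + b * ∫ u, G u ∂μ) / k := by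
  have h1 : Integrable (fun u => a * F u) μ := hF.const_mul a
  have h2 : Integrable (fun u => b * G u) μ := hG.const_mul b
  have h3 : Integrable (fun u => a * F u + b * G u) μ := h1.add h2
  rw [integral_add (integrable_const c) (h3.div_const k), integral_div, integral_add h1 h2,
    integral_const_mul, integral_const_mul]
  simp

/-- The average of the responses `Y_i` over the points `X_i` in `T`, with `0/0 = 0`. -/
def localAverage {n : ℕ} (T : Set (Pt d)) (Z : Fin n → Pt d × ℝ) : ℝ :=
  (∑ i, (Z i).2 * T.indicator 1 (Z i).1) / ∑ i, T.indicator (1 : Pt d → ℝ) (Z i).1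

lemma boxKernel_eq (d : ℕ) {h : ℝ} (hh : 0 < h) (t : ℝ) :
    boxKernel d h t = (h ^ d)⁻¹ * {s : ℝ | |s| ≤ h}.indicator 1 t := by
  unfold boxKernel
  congr 1
  simp only [indicator_apply, mem_ofPred_eq, abs_div, abs_of_pos hh, div_le_one hh, Pi.one_apply]

lemma estimator_eq_localAverage {n m : ℕ} (K : ℝ → ℝ) {h : ℝ} (hh : 0 < h) (α σ : ℝ)
    (Z : Fin n → Pt d × ℝ) (U : Fin m → Pt d) (x : Pt d) :
    estimator K h α σ Z U x = localAverage {x' | |estimatedMetric K α σ U x x'| ≤ h} Z := by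
  unfold estimator localAverage
  simp_rw [boxKernel_eq d hh]
  have : ∀ i, {s : ℝ | |s| ≤ h}.indicator (1 : ℝ → ℝ) (estimatedMetric K α σ U x (Z i).1)
      = {x' | |estimatedMetric K α σ U x x'| ≤ h}.indicator (1 : Pt d → ℝ) (Z i).1 := by
    intro i
    simp only [indicator_apply, mem_ofPred_eq, Pi.one_apply]
  simp_rw [this, mul_left_comm _ ((h ^ d)⁻¹)]
  rw [← Finset.mul_sum, ← Finset.mul_sum, mul_div_mul_left _ _ (by positivity)]

lemma abs_localAverage_le {n : ℕ} {T : Set (Pt d)} {Z : Fin n → Pt d × ℝ} {M : ℝ} (hM : 0 ≤ M)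
    (hZ : ∀ i, |(Z i).2| ≤ M) : |localAverage T Z| ≤ M := by
  unfold localAverage
  have h0 : ∀ i, 0 ≤ T.indicator (1 : Pt d → ℝ) (Z i).1 :=
    fun i => indicator_nonneg (fun _ _ => zero_le_one) _
  have hN : 0 ≤ ∑ i, T.indicator (1 : Pt d → ℝ) (Z i).1 := Finset.sum_nonneg fun i _ => h0 i
  rw [abs_div, abs_of_nonneg hN]
  refine div_le_of_le_mul₀ hN hM ((Finset.abs_sum_le_sum_abs _ _).trans ?_)
  rw [Finset.mul_sum]
  refine Finset.sum_le_sum fun i _ => ?_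
  rw [abs_mul, abs_of_nonneg (h0 i)]
  exact mul_le_mul_of_nonneg_right (hZ i) (h0 i)

/-- A ratio estimate deviates from `y₀` by at most the bias and the deviations of its numerator
and denominator from their means. -/
lemma sq_div_sub_le {N V a e M B y₀ : ℝ} (ha : 0 < a) (hy : |y₀| ≤ M)
    (hVN : |V / N| ≤ M) (he : |e - a * y₀| ≤ a * B) :
    (V / N - y₀) ^ 2 ≤ 12 * B ^ 2 + (12 * (V - e) ^ 2 + 28 * M ^ 2 * (N - a) ^ 2) / a ^ 2 := by
  have hM : 0 ≤ M := (abs_nonneg _).trans hy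
  -- If the denominator is below half its mean, the error is at most `2 M` while `(N - a)² ≥ a² /
  -- 4`, which needs the constant `16`. Otherwise division by `N` is safe and `12` suffices; `28`
  -- covers both.
  rcases lt_or_ge N (a / 2) with hlt | hge
  · have h1 : |V / N - y₀| ≤ 2 * M := (abs_sub _ _).trans (by linarith)
    have h2 : (V / N - y₀) ^ 2 ≤ 4 * M ^ 2 := by
      rw [← sq_abs]
      nlinarith [abs_nonneg (V / N - y₀)]
    have h3 : a ^ 2 ≤ 4 * (N - a) ^ 2 := by nlinarith
    have h4 : 4 * M ^ 2 ≤ (12 * (V - e) ^ 2 + 28 * M ^ 2 * (N - a) ^ 2) / a ^ 2 := by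
      rw [le_div_iff₀ (by positivity)]
      nlinarith [sq_nonneg (V - e), mul_le_mul_of_nonneg_left h3 (sq_nonneg M),
        mul_nonneg (sq_nonneg M) (sq_nonneg (N - a))]
    nlinarith [sq_nonneg B]
  · have hN : 0 < N := by linarith
    have h1 : V / N - y₀ = ((V - e) + (e - a * y₀) - (N - a) * y₀) / N := by
      field_simp; ring
    have h2 : ((V - e) + (e - a * y₀) - (N - a) * y₀) ^ 2
        ≤ 3 * ((V - e) ^ 2 + a ^ 2 * B ^ 2 + M ^ 2 * (N - a) ^ 2) := by
      have e1 : (e - a * y₀) ^ 2 ≤ a ^ 2 * B ^ 2 := by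
        rw [← mul_pow, ← sq_abs]
        exact pow_le_pow_left₀ (abs_nonneg _) he 2
      have e2 : ((N - a) * y₀) ^ 2 ≤ M ^ 2 * (N - a) ^ 2 := by
        rw [mul_pow, mul_comm]
        refine mul_le_mul_of_nonneg_right ?_ (sq_nonneg _)
        rw [← sq_abs]
        exact pow_le_pow_left₀ (abs_nonneg _) hy 2
      nlinarith [sq_nonneg ((V - e) - (e - a * y₀)), sq_nonneg ((V - e) + (N - a) * y₀),
        sq_nonneg ((e - a * y₀) + (N - a) * y₀)]
    rw [h1, div_pow]
    have h3 : a ^ 2 ≤ 4 * N ^ 2 := by nlinarith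
    calc _ ≤ 3 * ((V - e) ^ 2 + a ^ 2 * B ^ 2 + M ^ 2 * (N - a) ^ 2) / N ^ 2 := by gcongr
      _ ≤ 3 * ((V - e) ^ 2 + a ^ 2 * B ^ 2 + M ^ 2 * (N - a) ^ 2) / (a ^ 2 / 4) := by
        apply div_le_div_of_nonneg_left (by positivity) (by positivity)
        linarith
      _ = 12 * B ^ 2 + (12 * (V - e) ^ 2 + 12 * M ^ 2 * (N - a) ^ 2) / a ^ 2 := by
        field_simp; ring
      _ ≤ _ := by gcongr; norm_num

section

variable (P : Measure (Pt d × ℝ)) [IsProbabilityMeasure P]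

instance : IsProbabilityMeasure (marginal P) :=
  Measure.isProbabilityMeasure_map measurable_fst.aemeasurable

lemma measurable_regression : Measurable (regression P) :=
  (measurable_snd.stronglyMeasurable.integral_kernel_prod_right'
    (κ := P.condKernel) (f := fun q : Pt d × ℝ => q.2)).measurable

variable {P}

lemma integrable_mul_indicator {M : ℝ} (hY : ∀ᵐ z ∂P, |z.2| ≤ M) {T : Set (Pt d)}
    (hT : MeasurableSet T) :
    MemLp (fun z : Pt d × ℝ => z.2 * T.indicator 1 z.1) 2 P := by
  refine MemLp.of_bound (C := M) ?_ ?_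
  · exact (measurable_snd.mul ((measurable_one.indicator hT).comp measurable_fst)).aestronglyMeasurable
  · filter_upwards [hY] with z hz
    rw [norm_mul, Real.norm_eq_abs]
    refine (mul_le_of_le_one_right (abs_nonneg _) ?_).trans hz
    by_cases h : z.1 ∈ T <;> simp [h]

lemma abs_regression_le {M : ℝ} (hY : ∀ᵐ z ∂P, |z.2| ≤ M) :
    ∀ᵐ x ∂(marginal P), |regression P x| ≤ M := by
  rw [← P.disintegrate P.condKernel] at hY
  filter_upwards [Measure.ae_ae_of_ae_compProd hY] with x hx
  have := norm_integral_le_of_norm_le_const (μ := P.condKernel x) (f := fun y => y) hx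
  simpa [regression] using this

lemma integral_mul_indicator_eq {M : ℝ} (hY : ∀ᵐ z ∂P, |z.2| ≤ M) {T : Set (Pt d)}
    (hT : MeasurableSet T) :
    ∫ z, z.2 * T.indicator 1 z.1 ∂P = ∫ x in T, regression P x ∂(marginal P) := by
  rw [← Measure.integral_condKernel ((integrable_mul_indicator hY hT).integrable (by norm_num)),
    ← integral_indicator hT]
  refine integral_congr_ae (ae_of_all _ fun x => ?_)
  simp only [integral_mul_const]
  by_cases h : x ∈ T <;> simp [h, regression]

/-- `sq_div_sub_le` is applied to numerator and denominator with means `n e` and `n q`. Their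
variances are at most `n M² q` and `n q`, and `12 + 28 = 40`. -/
lemma lintegral_localAverage_le {M B y₀ : ℝ} (hM : 0 < M) (hY : ∀ᵐ z ∂P, |z.2| ≤ M)
    {T : Set (Pt d)} (hT : MeasurableSet T) (hy : |y₀| ≤ M)
    (hbias : ∀ᵐ x ∂(marginal P), x ∈ T → |regression P x - y₀| ≤ B) {n : ℕ} (hn : 0 < n) :
    ∫⁻ Z : Fin n → Pt d × ℝ, ENNReal.ofReal ((localAverage T Z - y₀) ^ 2)
        ∂(Measure.pi fun _ : Fin n => P)
      ≤ ENNReal.ofReal (12 * B ^ 2) + ENNReal.ofReal (40 * M ^ 2 / n) * (marginal P T)⁻¹ := by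
  have hn' : (0 : ℝ) < n := by exact_mod_cast hn
  -- A null neighborhood makes the right-hand side infinite.
  rcases eq_or_ne (marginal P T) 0 with h0 | h0
  · rw [h0, ENNReal.inv_zero, ENNReal.mul_top (by simp; positivity)]
    simp
  set q := (marginal P).real T with hq
  have hq0 : 0 < q := ENNReal.toReal_pos h0 (measure_ne_top _ _)
  set e := ∫ z, z.2 * T.indicator 1 z.1 ∂P with he
  have he' : |e - q * y₀| ≤ q * B := by
    have hint : IntegrableOn (regression P) T (marginal P) :=
      (Integrable.of_bound (measurable_regression P).aestronglyMeasurable (C := M)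
        (abs_regression_le hY)).integrableOn
    have h1 : e - q * y₀ = ∫ x in T, (regression P x - y₀) ∂(marginal P) := by
      rw [integral_sub hint (integrable_const _), he, integral_mul_indicator_eq hY hT]
      simp [hq]
    rw [h1]
    have := norm_setIntegral_le_of_norm_le_const_ae (μ := marginal P) (s := T) (C := B)
      (f := fun x => regression P x - y₀) (measure_lt_top _ _)
      ((ae_restrict_iff' hT).2 hbias)
    rw [mul_comm]
    exact this
  have h1 := integral_sq_sum_sub_le (integrable_mul_indicator hY hT) n
  have hind : MemLp (fun z : Pt d × ℝ => T.indicator (1 : Pt d → ℝ) z.1) 2 P := by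
    refine MemLp.of_bound (C := 1) ?_ (ae_of_all _ fun z => ?_)
    · exact ((measurable_one.indicator hT).comp measurable_fst).aestronglyMeasurable
    · by_cases h : z.1 ∈ T <;> simp [h]
  have h2 := integral_sq_sum_sub_le hind n
  have hiq : ∫ z, T.indicator (1 : Pt d → ℝ) z.1 ∂P = q := by
    have : ∫ z, T.indicator (1 : Pt d → ℝ) z.1 ∂P = ∫ x, T.indicator (1 : Pt d → ℝ) x ∂(marginal P) := by
      rw [marginal, integral_map measurable_fst.aemeasurable
        (measurable_one.indicator hT).aestronglyMeasurable]
    rw [this, integral_indicator_one hT]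
  have hisq : ∫ z, T.indicator (1 : Pt d → ℝ) z.1 ^ 2 ∂P = q := by
    rw [← hiq]
    congr 1
    ext z
    by_cases h : z.1 ∈ T <;> simp [h]
  have hYsq : ∫ z, (z.2 * T.indicator (1 : Pt d → ℝ) z.1) ^ 2 ∂P ≤ M ^ 2 * q := by
    rw [← hisq, ← integral_const_mul]
    refine integral_mono_ae (integrable_mul_indicator hY hT).integrable_sq
      (hind.integrable_sq.const_mul _) ?_
    filter_upwards [hY] with z hz
    simp only [mul_pow]
    refine mul_le_mul_of_nonneg_right ?_ (sq_nonneg _)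
    rw [← sq_abs]
    exact pow_le_pow_left₀ (abs_nonneg _) hz 2
  rw [hiq, hisq] at h2
  have hae : ∀ᵐ Z : Fin n → Pt d × ℝ ∂(Measure.pi fun _ : Fin n => P), ∀ i, |(Z i).2| ≤ M :=
    ae_all_iff.2 fun i => (measurePreserving_eval (fun _ : Fin n => P) i).quasiMeasurePreserving.ae hY
  set G : (Fin n → Pt d × ℝ) → ℝ := fun Z => 12 * B ^ 2 +
    (12 * (∑ i, (Z i).2 * T.indicator 1 (Z i).1 - n * e) ^ 2
      + 28 * M ^ 2 * (∑ i, T.indicator (1 : Pt d → ℝ) (Z i).1 - n * q) ^ 2) / (n * q) ^ 2 with hG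
  have hGint : Integrable G (Measure.pi fun _ : Fin n => P) :=
    (integrable_const _).add (((h1.1.const_mul _).add (h2.1.const_mul _)).div_const _)
  have hG0 : ∀ Z, 0 ≤ G Z := fun Z => by positivity
  have hle : ∫⁻ Z : Fin n → Pt d × ℝ, ENNReal.ofReal ((localAverage T Z - y₀) ^ 2)
        ∂(Measure.pi fun _ : Fin n => P) ≤ ∫⁻ Z, ENNReal.ofReal (G Z)
        ∂(Measure.pi fun _ : Fin n => P) := by
    refine lintegral_mono_ae ?_
    filter_upwards [hae] with Z hZ
    refine ENNReal.ofReal_le_ofReal (sq_div_sub_le (by positivity) hy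
      (abs_localAverage_le hM.le hZ) ?_)
    rw [show (n : ℝ) * e - n * q * y₀ = n * (e - q * y₀) by ring, abs_mul, abs_of_pos hn', mul_assoc]
    exact mul_le_mul_of_nonneg_left he' hn'.le
  refine hle.trans ?_
  rw [← ofReal_integral_eq_lintegral_ofReal hGint (ae_of_all _ hG0)]
  have hval : ∫ Z, G Z ∂(Measure.pi fun _ : Fin n => P) ≤ 12 * B ^ 2 + 40 * M ^ 2 / n * q⁻¹ := by
    rw [hG, integral_const_add_div h1.1 h2.1]
    gcongr
    rw [div_le_iff₀ (by positivity)]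
    have e1 := h1.2.trans (mul_le_mul_of_nonneg_left hYsq hn'.le)
    have e2 := mul_le_mul_of_nonneg_left h2.2 (show 0 ≤ 28 * M ^ 2 by positivity)
    have e3 : 40 * M ^ 2 / n * q⁻¹ * (n * q) ^ 2 = 40 * M ^ 2 * (n * q) := by
      field_simp
    rw [e3]
    linarith
  refine (ENNReal.ofReal_le_ofReal hval).trans ?_
  rw [ENNReal.ofReal_add (by positivity) (by positivity),
    ENNReal.ofReal_mul (p := 40 * M ^ 2 / n) (by positivity),
    ENNReal.ofReal_inv_of_pos hq0, hq, ofReal_measureReal]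

/-- Almost every `x` lies in some `A j` with `μ (A j) ≤ μ (S x)`, so `1 / μ (S x)` is at most the
sum of the functions `1_{A j} / μ (A j)`, each of integral at most `1`, also when `A j` is null. -/
lemma lintegral_inv_measure_le {E : Type*} [MeasurableSpace E] {μ : Measure E}
    {S : E → Set E} {c : Finset E} {A : E → Set E} (hA : ∀ j ∈ c, MeasurableSet (A j))
    (hcov : ∀ᵐ x ∂μ, ∃ j ∈ c, x ∈ A j)
    (hle : ∀ j ∈ c, ∀ᵐ x ∂μ, x ∈ A j → μ (A j) ≤ μ (S x)) :
    ∫⁻ x, (μ (S x))⁻¹ ∂μ ≤ c.card := by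
  classical
  have h1 : ∀ᵐ x ∂μ, (μ (S x))⁻¹ ≤ ∑ j ∈ c, (A j).indicator (fun _ => (μ (A j))⁻¹) x := by
    filter_upwards [hcov, (Finset.eventually_all c).2 hle] with x ⟨j, hj, hx⟩ h2
    refine le_trans ?_ (Finset.single_le_sum (f := fun j => (A j).indicator (fun _ => (μ (A j))⁻¹) x)
      (fun _ _ => zero_le) hj)
    simp only [indicator_of_mem hx]
    exact ENNReal.inv_le_inv.2 (h2 j hj hx)
  refine (lintegral_mono_ae h1).trans ?_
  rw [lintegral_finsetSum' _ fun j hj => (measurable_const.indicator (hA j hj)).aemeasurable]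
  calc _ ≤ ∑ _j ∈ c, (1 : ℝ≥0∞) := by
        refine Finset.sum_le_sum fun j hj => ?_
        rw [lintegral_indicator_const (hA j hj)]
        exact ENNReal.inv_mul_le_one _
    _ = c.card := by simp

end

lemma measurableSet_cube (d : ℕ) : MeasurableSet (cube d) := by
  have : cube d = ⋂ i, (fun x : Pt d => x i) ⁻¹' Icc (0 : ℝ) 1 := by
    ext x
    simp only [cube, mem_ofPred_eq, mem_iInter, mem_preimage]
  rw [this]
  refine MeasurableSet.iInter fun i => measurableSet_Icc.preimage ?_
  fun_prop

section

variable {P : Measure (Pt d × ℝ)} [IsProbabilityMeasure P]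

lemma measurable_localAverage {S : Set (Pt d × Pt d)} (hS : MeasurableSet S) (n : ℕ) :
    Measurable fun q : (Fin n → Pt d × ℝ) × Pt d => localAverage {x' | (q.2, x') ∈ S} q.1 := by
  have hind : ∀ i : Fin n, Measurable fun q : (Fin n → Pt d × ℝ) × Pt d =>
      {x' | (q.2, x') ∈ S}.indicator (1 : Pt d → ℝ) (q.1 i).1 := by
    intro i
    have : Measurable fun q : (Fin n → Pt d × ℝ) × Pt d =>
        S.indicator (1 : Pt d × Pt d → ℝ) (q.2, (q.1 i).1) :=
      (measurable_one.indicator hS).comp (by fun_prop)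
    exact this
  unfold localAverage
  refine Measurable.div (Finset.measurable_fun_sum _ fun i _ => Measurable.mul ?_ (hind i))
    (Finset.measurable_fun_sum _ fun i _ => hind i)
  fun_prop

/-- The risk of the local average over the neighborhoods `{x' | (x, x') ∈ S}` of the points `x`. -/
lemma lintegral_risk_localAverage_le {M B : ℝ} (hM : 0 < M) (hY : ∀ᵐ z ∂P, |z.2| ≤ M)
    {S : Set (Pt d × Pt d)} (hS : MeasurableSet S)
    (hbias : ∀ᵐ x ∂(marginal P), ∀ᵐ x' ∂(marginal P), (x, x') ∈ S →
      |regression P x' - regression P x| ≤ B) {c : Finset (Pt d)} {A : Pt d → Set (Pt d)}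
    (hA : ∀ j ∈ c, MeasurableSet (A j)) (hcov : ∀ᵐ x ∂(marginal P), ∃ j ∈ c, x ∈ A j)
    (hAS : ∀ j ∈ c, ∀ x ∈ A j, ∀ x' ∈ A j, (x, x') ∈ S) {n : ℕ} (hn : 0 < n) :
    ∫⁻ Z : Fin n → Pt d × ℝ, (∫⁻ x, ENNReal.ofReal
        ((localAverage {x' | (x, x') ∈ S} Z - regression P x) ^ 2) ∂(marginal P))
        ∂(Measure.pi fun _ : Fin n => P)
      ≤ ENNReal.ofReal (12 * B ^ 2) + ENNReal.ofReal (40 * M ^ 2 / n) * c.card := by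
  have hSx : ∀ x, MeasurableSet {x' | (x, x') ∈ S} := fun x => measurable_prodMk_left hS
  rw [lintegral_lintegral_swap]
  · calc _ ≤ ∫⁻ x, (ENNReal.ofReal (12 * B ^ 2) + ENNReal.ofReal (40 * M ^ 2 / n)
          * (marginal P {x' | (x, x') ∈ S})⁻¹) ∂(marginal P) := by
          refine lintegral_mono_ae ?_
          filter_upwards [hbias, abs_regression_le hY] with x hx hx'
          exact lintegral_localAverage_le hM hY (hSx x) hx' hx hn
      _ = ENNReal.ofReal (12 * B ^ 2) + ENNReal.ofReal (40 * M ^ 2 / n)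
          * ∫⁻ x, (marginal P {x' | (x, x') ∈ S})⁻¹ ∂(marginal P) := by
          rw [lintegral_add_left measurable_const, lintegral_const_mul' _ _ ENNReal.ofReal_ne_top]
          simp
      _ ≤ _ := by
          gcongr
          refine lintegral_inv_measure_le hA hcov fun j hj => ae_of_all _ fun x hx => ?_
          exact measure_mono fun x' hx' => hAS j hj x hx x' hx'
  · refine Measurable.aemeasurable (Measurable.ennreal_ofReal (Measurable.pow_const ?_ 2))
    exact (measurable_localAverage hS n).sub ((measurable_regression P).comp measurable_snd)

lemma lintegral_risk_le_of_bounded {M : ℝ} (hM : 0 < M) (hY : ∀ᵐ z ∂P, |z.2| ≤ M)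
    (T : Pt d → Set (Pt d)) (n : ℕ) :
    ∫⁻ Z : Fin n → Pt d × ℝ, (∫⁻ x, ENNReal.ofReal
        ((localAverage (T x) Z - regression P x) ^ 2) ∂(marginal P))
        ∂(Measure.pi fun _ : Fin n => P) ≤ ENNReal.ofReal (4 * M ^ 2) := by
  have hae : ∀ᵐ Z : Fin n → Pt d × ℝ ∂(Measure.pi fun _ : Fin n => P), ∀ i, |(Z i).2| ≤ M :=
    ae_all_iff.2 fun i => (measurePreserving_eval (fun _ : Fin n => P) i).quasiMeasurePreserving.ae hY
  calc _ ≤ ∫⁻ _Z : Fin n → Pt d × ℝ, ENNReal.ofReal (4 * M ^ 2)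
        ∂(Measure.pi fun _ : Fin n => P) := by
        refine lintegral_mono_ae ?_
        filter_upwards [hae] with Z hZ
        calc _ ≤ ∫⁻ _x, ENNReal.ofReal (4 * M ^ 2) ∂(marginal P) := by
              refine lintegral_mono_ae ?_
              filter_upwards [abs_regression_le hY] with x hx
              refine ENNReal.ofReal_le_ofReal ?_
              have h1 : |localAverage (T x) Z - regression P x| ≤ 2 * M :=
                (abs_sub _ _).trans (by linarith [abs_localAverage_le (T := T x) hM.le hZ])
              rw [← sq_abs]
              nlinarith [abs_nonneg (localAverage (T x) Z - regression P x)]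
          _ = _ := by simp
    _ = _ := by simp

end

/-! ### Risk given the unlabeled points -/

/-- Integrating a function over a product when it is bounded by `a` outside a set of second
coordinates and by `b` everywhere. -/
lemma lintegral_prod_le_add {Ω₁ Ω₂ : Type*} [MeasurableSpace Ω₁] [MeasurableSpace Ω₂]
    {μ : Measure Ω₁} {ν : Measure Ω₂} [IsProbabilityMeasure μ] [IsProbabilityMeasure ν]
    {F : Ω₁ → Ω₂ → ℝ≥0∞} {a b : ℝ≥0∞} {bad : Set Ω₂}
    (ha : ∀ u ∉ bad, ∫⁻ z, F z u ∂μ ≤ a) (hb : ∀ u, ∫⁻ z, F z u ∂μ ≤ b) :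
    ∫⁻ w, F w.1 w.2 ∂(μ.prod ν) ≤ a + b * ν bad := by
  rw [← lintegral_prod_swap]
  -- This inequality between the product and iterated integrals needs no measurability of `F`, and
  -- `bad` is replaced by a measurable hull of the same measure. So nothing need be known about
  -- measurability in the unlabeled points.
  refine (lintegral_prod_le _).trans ?_
  calc _ ≤ ∫⁻ u, (a + (toMeasurable ν bad).indicator (fun _ => b) u) ∂ν := by
        refine lintegral_mono fun u => ?_
        by_cases hu : u ∈ toMeasurable ν bad
        · simp only [indicator_of_mem hu]
          exact (hb u).trans le_add_self
        · simp only [indicator_of_notMem hu, add_zero]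
          exact ha u fun h => hu (subset_toMeasurable ν bad h)
    _ = _ := by
        rw [lintegral_add_left measurable_const,
          lintegral_indicator_const (measurableSet_toMeasurable _ _), measure_toMeasurable]
        simp

lemma continuous_estimatedMetric {K : ℝ → ℝ} {b A β R σ : ℝ} (hK : KernelBounds d K b A β R)
    (hσ : 0 < σ) {α : ℝ} (hα : 0 ≤ α) (μ : Measure (Pt d)) [IsProbabilityMeasure μ] :
    Continuous fun q : Pt d × Pt d => expMetric α (smoothedDensity K σ μ) q.1 q.2 := by
  rw [expMetric_eq_weightMetric]
  exact continuous_weightMetric (exp_weight_continuous (hK.density_continuous μ hσ))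
    (exp_weight_nonneg _ _) (exp_weight_le_one hα (hK.density_nonneg μ hσ))

/-- The conditional risk given the unlabeled points, when the estimated metric is comparable to
the population metric. -/
lemma lintegral_risk_estimator_le {K : ℝ → ℝ} {b A β R σ : ℝ} (hK : KernelBounds d K b A β R)
    (hσ : 0 < σ) {α : ℝ} (hα : 0 ≤ α) {L M : ℝ} (hL : 0 ≤ L) (hM : 0 < M)
    {P : ProbabilityMeasure (Pt d × ℝ)} (hP : P ∈ smoothClass d K L M α σ) {n m : ℕ} (hn : 0 < n)
    (hm : 0 < m) {U : Fin m → Pt d} {a τ ε h : ℝ} (ha : 0 ≤ a) (hh : 0 < h)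
    (h1 : ∀ x y, estimatedMetric K α σ U x y
      ≤ a * populationMetric K α σ (P : Measure (Pt d × ℝ)) x y + τ)
    (h2 : ∀ x y, populationMetric K α σ (P : Measure (Pt d × ℝ)) x y
      ≤ a * estimatedMetric K α σ U x y + τ)
    (hε : a * (2 * ε) + τ ≤ h) {c : Finset (Pt d)}
    (hc : ∀ z ∈ (marginal (P : Measure (Pt d × ℝ))).support, ∃ x ∈ c,
      populationMetric K α σ (P : Measure (Pt d × ℝ)) x z ≤ ε) :
    ∫⁻ Z : Fin n → Pt d × ℝ, (∫⁻ x, ENNReal.ofReal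
        ((estimator K h α σ Z U x - regression (P : Measure (Pt d × ℝ)) x) ^ 2)
        ∂(marginal (P : Measure (Pt d × ℝ)))) ∂(Measure.pi fun _ : Fin n => (P : Measure (Pt d × ℝ)))
      ≤ ENNReal.ofReal (12 * (L * (a * h + τ)) ^ 2) + ENNReal.ofReal (40 * M ^ 2 / n) * c.card := by
  obtain ⟨hae, f, hf, hfL⟩ := hP
  have hprob := isProbabilityMeasure_empirical hm U
  set μ := marginal (P : Measure (Pt d × ℝ)) with hμ
  have hcontE : Continuous fun q : Pt d × Pt d => estimatedMetric K α σ U q.1 q.2 := by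
    rw [estimatedMetric, kde_eq_smoothedDensity]
    exact continuous_estimatedMetric hK hσ hα _
  have hcontP : Continuous fun q : Pt d × Pt d =>
      populationMetric K α σ (P : Measure (Pt d × ℝ)) q.1 q.2 :=
    continuous_estimatedMetric hK hσ hα _
  have hE0 : ∀ x y, 0 ≤ estimatedMetric K α σ U x y := fun x y =>
    weightMetric_nonneg (exp_weight_nonneg _ _) x y
  set S : Set (Pt d × Pt d) := {q | |estimatedMetric K α σ U q.1 q.2| ≤ h} with hS
  have hSm : MeasurableSet S := (isClosed_le hcontE.abs continuous_const).measurableSet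
  simp_rw [estimator_eq_localAverage K hh]
  -- The neighborhoods are estimated balls, the covering sets population balls. Two points of one
  -- covering ball are at population distance at most `2 ε`, hence at estimated distance at most `a
  -- (2 ε) + τ ≤ h`.
  refine lintegral_risk_localAverage_le (S := S)
    (A := fun x => {z | populationMetric K α σ (P : Measure (Pt d × ℝ)) x z ≤ ε})
    hM (hae.mono fun z hz => hz.2) hSm ?_ ?_ ?_ ?_ hn
  · have hcube : ∀ᵐ x ∂μ, x ∈ cube d :=
      (ae_map_iff measurable_fst.aemeasurable (measurableSet_cube d)).2 (hae.mono fun z hz => hz.1)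
    filter_upwards [hf, hcube] with x hx hxc
    filter_upwards [hf, hcube] with x' hx' hxc' hmem
    rw [← hx, ← hx', abs_sub_comm]
    refine (hfL x hxc x' hxc').trans (mul_le_mul_of_nonneg_left ((h2 x x').trans ?_) hL)
    have hmem' : |estimatedMetric K α σ U x x'| ≤ h := hmem
    have := (le_abs_self _).trans hmem'
    gcongr
  · intro j _
    exact (isClosed_le (hcontP.comp (by fun_prop : Continuous fun z : Pt d => (j, z)))
      continuous_const).measurableSet
  · filter_upwards [Measure.support_mem_ae (μ := μ)] with x hx
    exact hc x hx
  · intro j _ x hx x' hx'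
    change |estimatedMetric K α σ U x x'| ≤ h
    rw [abs_of_nonneg (hE0 _ _)]
    refine (h1 x x').trans (le_trans ?_ hε)
    gcongr
    have htri := weightMetric_triangle
      (exp_weight_continuous (α := α) (hK.density_continuous μ hσ)) (exp_weight_nonneg _ _) x j x'
    rw [weightMetric_comm _ x j] at htri
    have hx1 : weightMetric (fun z => Real.exp (-α * smoothedDensity K σ μ z)) j x ≤ ε := hx
    have hx2 : weightMetric (fun z => Real.exp (-α * smoothedDensity K σ μ z)) j x' ≤ ε := hx'
    exact htri.trans (by linarith)

/-! ### Uniform comparison of the estimated and population metrics -/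

/-- Two metrics agree up to the factor `a` and the additive error `τ`. -/
def MetricsComparable (a τ : ℝ) (D D' : Pt d → Pt d → ℝ) : Prop :=
  ∀ x y, D' x y ≤ a * D x y + τ ∧ D x y ≤ a * D' x y + τ

/-- A union bound over the `k^d` grid points; almost surely the sample stays in the cube, so the
empirical density also vanishes outside the box. -/
lemma measure_not_metricsComparable_le {K : ℝ → ℝ} {b A β R σ : ℝ} (hK : KernelBounds d K b A β R)
    (hσ : 0 < σ) (μ : Measure (Pt d)) [IsProbabilityMeasure μ] (hμ : ∀ᵐ u ∂μ, u ∈ cube d)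
    {m : ℕ} (hm : 0 < m) {α δ Λ s Rb r : ℝ} {k : ℕ} (hα : 0 ≤ α) (hδ : 0 ≤ δ) (hs : 0 ≤ s)
    (hsκ : s * (α * (b / σ ^ d) / m) ≤ 1 / 4) (hsΛ : s * (α * (b / σ ^ d) / m) * Λ ≤ δ / 2)
    (hΛ : 2 * δ ≤ Λ) (hRb : 1 + R * σ ≤ Rb) (hk : 0 < k) (hr : r = d * (2 * Rb / k))
    (hhol : α * (A * (r / σ) ^ β / σ ^ d) ≤ δ) :
    Measure.pi (fun _ : Fin m => μ) {U | ¬ MetricsComparable (Real.exp (3 * δ))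
        ((k : ℝ) ^ d * (2 * r * Real.exp (δ - Λ / 2)))
        (expMetric α (smoothedDensity K σ μ)) (expMetric α (kde K σ U))}
      ≤ ENNReal.ofReal ((k : ℝ) ^ d * (2 * Real.exp (-(s * δ / 2)))) := by
  have hcube : Measure.pi (fun _ : Fin m => μ) {U | ¬ ∀ j, U j ∈ cube d} = 0 :=
    ae_iff.1 (ae_all_iff.2 fun j =>
      (measurePreserving_eval (fun _ : Fin m => μ) j).quasiMeasurePreserving.ae hμ)
  have hsub : {U | ¬ MetricsComparable (Real.exp (3 * δ))
        ((k : ℝ) ^ d * (2 * r * Real.exp (δ - Λ / 2)))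
        (expMetric α (smoothedDensity K σ μ)) (expMetric α (kde K σ U))} ⊆
      {U : Fin m → Pt d | ¬ ∀ j, U j ∈ cube d} ∪ ⋃ v : Fin d → Fin k,
        {U | ¬ GoodAt α δ Λ (smoothedDensity K σ μ (gridPoint Rb v))
          (kde K σ U (gridPoint Rb v))} := by
    intro U hU
    by_contra hcon
    simp only [mem_union, mem_iUnion, mem_ofPred_eq, not_or, not_exists, not_not] at hcon
    obtain ⟨hUc, hgood⟩ := hcon
    refine hU fun x y => ?_
    have := isProbabilityMeasure_empirical hm U
    have hν := ae_empirical hUc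
    have hcmp := fun v => (hgood v).comparable (by linarith)
    rw [kde_eq_smoothedDensity] at hcmp ⊢
    exact ⟨expMetric_le_of_comparable hK hσ hμ hν hα hδ hRb hk hr hhol hcmp x y,
      expMetric_le_of_comparable hK hσ hν hμ hα hδ hRb hk hr hhol (fun v => (hcmp v).symm) x y⟩
  refine (measure_mono hsub).trans ((measure_union_le _ _).trans ?_)
  rw [hcube, zero_add]
  refine (measure_iUnion_le _).trans ?_
  rw [tsum_fintype]
  refine (Finset.sum_le_sum fun v _ => measure_not_goodAt_le hK hσ μ hm hα hs hsκ hsΛ hΛ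
    (gridPoint Rb v)).trans ?_
  rw [Finset.sum_const, nsmul_eq_mul, ENNReal.ofReal_mul (by positivity)]
  simp

open Filter Topology in
lemma eventually_mul_pow_mul_exp_le (C : ℝ) (N : ℕ) {c p ε : ℝ} (hc : 0 < c) (hp : 0 < p)
    (hε : 0 < ε) :
    ∀ᶠ m : ℕ in atTop, C * (m : ℝ) ^ N * Real.exp (-(c * (m : ℝ) ^ p)) ≤ ε := by
  have h1 := (tendsto_rpow_mul_exp_neg_mul_atTop_nhds_zero ((N : ℝ) / p) c hc).comp
    ((tendsto_rpow_atTop hp).comp tendsto_natCast_atTop_atTop)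
  have h2 := h1.const_mul C
  rw [mul_zero] at h2
  filter_upwards [h2.eventually_lt_const hε] with m hm
  refine le_of_eq_of_le ?_ hm.le
  simp only [Function.comp]
  rw [← Real.rpow_mul (Nat.cast_nonneg m), mul_div_cancel₀ _ hp.ne', Real.rpow_natCast]
  ring_nf

/-- Let `t = m^(γ/(1+γ)/8)`. The lower bound on `σ` gives `m σ^d ≥ t^8`. As `log m ≥ 1`, the
constraint on `α` gives `α ≤ √(m σ^d / C₂)`, and dividing by `m σ^d` leaves its inverse square root.
-/
lemma alpha_mul_le {C₂ γ : ℝ} {m : ℕ} {α σ : ℝ} (hd : 0 < d) (hγ : 0 < γ) (hC₂ : 0 < C₂)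
    (hm : 3 ≤ m) (hα : 0 ≤ α) (hdev : α * deviation d C₂ m σ ≤ Real.log 2)
    (hσ : (1 / (m : ℝ)) ^ (1 / ((d : ℝ) * (1 + γ))) ≤ σ) :
    α / (m * σ ^ d) ≤ (Real.sqrt C₂)⁻¹ * ((m : ℝ) ^ (γ / (1 + γ) / 8))⁻¹ ^ 4 := by
  have hm' : (0 : ℝ) < m := by exact_mod_cast (by omega : 0 < m)
  have hd' : (0 : ℝ) < d := by exact_mod_cast hd
  have hσ0 : 0 < σ := lt_of_lt_of_le (by positivity) hσ
  have hlog : 1 ≤ Real.log m := by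
    rw [Real.le_log_iff_exp_le hm']
    have h3 : (3 : ℝ) ≤ m := by exact_mod_cast hm
    linarith [Real.exp_one_lt_d9]
  set v := (m : ℝ) * σ ^ d with hv
  have hv0 : 0 < v := by positivity
  set t := (m : ℝ) ^ (γ / (1 + γ) / 8) with ht
  have ht0 : 0 < t := by positivity
  have hvt : t ^ 8 ≤ v := by
    have h1 : (1 / (m : ℝ)) ^ (1 / (1 + γ)) ≤ σ ^ d := by
      have := pow_le_pow_left₀ (by positivity) hσ d
      rw [← Real.rpow_natCast, ← Real.rpow_mul (by positivity)] at this
      refine le_of_eq_of_le ?_ this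
      congr 1
      field_simp
    have h2 : t ^ 8 = m * (1 / (m : ℝ)) ^ (1 / (1 + γ)) := by
      rw [ht, ← Real.rpow_natCast, ← Real.rpow_mul hm'.le, one_div, Real.inv_rpow hm'.le,
        ← Real.rpow_neg hm'.le]
      nth_rw 2 [← Real.rpow_one (m : ℝ)]
      rw [← Real.rpow_add hm']
      congr 1
      push_cast
      field_simp
      ring
    rw [h2]
    exact mul_le_mul_of_nonneg_left h1 hm'.le
  have hα1 : α * (Real.sqrt C₂ / Real.sqrt v) ≤ 1 := by
    refine le_trans (mul_le_mul_of_nonneg_left ?_ hα)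
      (hdev.trans (by linarith [Real.log_two_lt_d9]))
    rw [deviation, ← Real.sqrt_div hC₂.le]
    apply Real.sqrt_le_sqrt
    gcongr
    nlinarith
  have hsv : 0 < Real.sqrt v := Real.sqrt_pos.2 hv0
  have hsC : 0 < Real.sqrt C₂ := Real.sqrt_pos.2 hC₂
  have ht4 : t ^ 4 ≤ Real.sqrt v := by
    apply Real.le_sqrt_of_sq_le
    rw [← pow_mul]
    exact hvt
  have hα2 : α ≤ (Real.sqrt C₂)⁻¹ * Real.sqrt v := by
    rw [mul_div_assoc', div_le_one hsv] at hα1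
    rw [← div_eq_inv_mul, le_div_iff₀ hsC]
    exact hα1
  calc α / v ≤ (Real.sqrt C₂)⁻¹ * Real.sqrt v / v := by gcongr
    _ = (Real.sqrt C₂)⁻¹ * (Real.sqrt v)⁻¹ := by
      nth_rw 2 [← Real.mul_self_sqrt hv0.le]
      field_simp
    _ ≤ _ := by
      rw [inv_pow]
      gcongr

/-- The power `q` makes `(r / σ)^β` of order `m^(-2)`, which beats the growth `α / σ^d ≤ S m`. -/
lemma holder_error_le {m q : ℕ} {α σ A β D S r : ℝ} (hm : 0 < m) (hσ : 0 < σ)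
    (hσm : 1 / σ ≤ m) (hα : 0 ≤ α) (hA : 0 ≤ A) (hβ : 0 < β) (hq : 1 + 2 / β ≤ q) (hD : 0 ≤ D)
    (hS : α / σ ^ d ≤ S * m) (hr : r = D / m ^ q) :
    α * (A * (r / σ) ^ β / σ ^ d) ≤ A * S * D ^ β / m := by
  have hm' : (0 : ℝ) < m := by exact_mod_cast hm
  have hm1 : (1 : ℝ) ≤ m := by exact_mod_cast hm
  have hr0 : 0 ≤ r := by rw [hr]; positivity
  have e1 : r / σ ≤ D * (m : ℝ) ^ (-(2 / β)) := by
    calc r / σ = r * (1 / σ) := by ring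
      _ ≤ r * m := mul_le_mul_of_nonneg_left hσm hr0
      _ = D * ((m : ℝ) ^ (1 - q : ℝ)) := by
        rw [Real.rpow_sub hm', Real.rpow_one, Real.rpow_natCast, hr]
        ring
      _ ≤ _ := mul_le_mul_of_nonneg_left
        (Real.rpow_le_rpow_of_exponent_le hm1 (by linarith)) hD
  have e2 : (r / σ) ^ β ≤ D ^ β * ((m : ℝ) ^ 2)⁻¹ := by
    refine (Real.rpow_le_rpow (by positivity) e1 hβ.le).trans_eq ?_
    rw [Real.mul_rpow hD (by positivity), ← Real.rpow_mul hm'.le]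
    congr 1
    rw [show -(2 / β) * β = -((2 : ℕ) : ℝ) by push_cast; field_simp, Real.rpow_neg hm'.le,
      Real.rpow_natCast]
  calc α * (A * (r / σ) ^ β / σ ^ d) = (α / σ ^ d) * (A * (r / σ) ^ β) := by ring
    _ ≤ (S * m) * (A * (D ^ β * ((m : ℝ) ^ 2)⁻¹)) :=
      mul_le_mul hS (mul_le_mul_of_nonneg_left e2 hA) (by positivity)
        ((by positivity : 0 ≤ α / σ ^ d).trans hS)
    _ = A * S * D ^ β / m := by field_simp

open Filter Topology in
/-- With probability at least `1 - 1/m` the estimated metric agrees with the population metric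
up to the factor `exp (3δ)` and an additive error `η / m`, uniformly over the admissible
parameters. -/
lemma exists_forall_measure_not_metricsComparable_le {K : ℝ → ℝ} {b A β R : ℝ}
    (hK : KernelBounds d K b A β R) (hd : 0 < d) {γ C₂ δ η : ℝ} (hγ : 0 < γ) (hC₂ : 0 < C₂)
    (hδ : 0 < δ) (hη : 0 < η) (σ₁ : ℝ) :
    ∃ m₀ : ℕ, ∀ m ≥ m₀, ∀ α σ : ℝ, 0 ≤ α → α * deviation d C₂ m σ ≤ Real.log 2 →
      (1 / (m : ℝ)) ^ (1 / ((d : ℝ) * (1 + γ))) ≤ σ → σ ≤ σ₁ →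
      ∀ (μ : Measure (Pt d)) [IsProbabilityMeasure μ], (∀ᵐ u ∂μ, u ∈ cube d) →
        Measure.pi (fun _ : Fin m => μ) {U | ¬ MetricsComparable (Real.exp (3 * δ)) (η / m)
          (expMetric α (smoothedDensity K σ μ)) (expMetric α (kde K σ U))}
          ≤ ENNReal.ofReal (1 / m) := by
  have hb := hK.b_pos
  have hA := hK.A_nonneg
  have hβ := hK.β_pos
  have hR := hK.R_nonneg
  have hd' : (1 : ℝ) ≤ d := by exact_mod_cast hd
  obtain ⟨q, hq⟩ := exists_nat_ge (1 + 2 / β)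
  set Rb := 1 + R * |σ₁| with hRb
  have hRb1 : 1 ≤ Rb := by have := mul_nonneg hR (abs_nonneg σ₁); linarith
  set κ₀ := b * (Real.sqrt C₂)⁻¹ with hκ₀
  have hsC : 0 < Real.sqrt C₂ := Real.sqrt_pos.2 hC₂
  have hκ₀0 : 0 < κ₀ := by positivity
  set g := γ / (1 + γ) / 8 with hg
  have hg0 : 0 < g := by positivity
  have ht : Tendsto (fun m : ℕ => (m : ℝ) ^ g) atTop atTop :=
    (tendsto_rpow_atTop hg0).comp tendsto_natCast_atTop_atTop
  set H := A * (Real.sqrt C₂)⁻¹ * (2 * d * Rb) ^ β with hH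
  have hH0 : 0 ≤ H := by positivity
  -- With `t = m^g` serving both as Chernoff parameter and as threshold `Λ`, and `m^q` grid points
  -- per axis, all requirements hold for large `m`. The last two say that the polynomial number of
  -- cells loses against `exp (-δ t / 2)` in the probability and against `exp (-t / 2)` in the
  -- additive error.
  have ev := (((((ht.eventually_ge_atTop 1).and (ht.eventually_ge_atTop (4 * κ₀))).and
    ((ht.eventually_ge_atTop (2 * κ₀ / δ)).and (ht.eventually_ge_atTop (2 * δ)))).and
    ((eventually_ge_atTop 3).and
      (tendsto_natCast_atTop_atTop.eventually_ge_atTop (H / δ)))).and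
    ((eventually_mul_pow_mul_exp_le 2 (q * d + 1) (c := δ / 2) (by positivity) hg0 one_pos).and
    (eventually_mul_pow_mul_exp_le (4 * d * Rb * Real.exp δ) (q * d + 1) (c := 1 / 2)
      (by positivity) hg0 hη)))
  obtain ⟨m₀, hm₀⟩ := eventually_atTop.1 ev
  refine ⟨m₀, fun m hm α σ hα hdev hσ hσ1 μ _ hμ => ?_⟩
  obtain ⟨⟨⟨⟨ht1, ht2⟩, ht3, ht4⟩, hm3, hmH⟩, hp1, hp2⟩ := hm₀ m hm
  have hm0 : 0 < m := by omega
  have hm' : (0 : ℝ) < m := by exact_mod_cast hm0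
  have hm1 : (1 : ℝ) ≤ m := by exact_mod_cast hm0
  have hσ0 : 0 < σ := lt_of_lt_of_le (by positivity) hσ
  set t := (m : ℝ) ^ g with htdef
  have ht0 : 0 < t := by linarith
  have hα4 := alpha_mul_le hd hγ hC₂ hm3 hα hdev hσ
  rw [← hg, ← htdef] at hα4
  have hκ : α * (b / σ ^ d) / m ≤ κ₀ * t⁻¹ ^ 4 := by
    calc α * (b / σ ^ d) / m = b * (α / (m * σ ^ d)) := by field_simp
      _ ≤ b * ((Real.sqrt C₂)⁻¹ * t⁻¹ ^ 4) := mul_le_mul_of_nonneg_left hα4 hb.le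
      _ = _ := by rw [hκ₀]; ring
  have hti : t⁻¹ ≤ 1 := inv_le_one_of_one_le₀ ht1
  have hti0 : 0 < t⁻¹ := by positivity
  have htt : t * t⁻¹ = 1 := mul_inv_cancel₀ ht0.ne'
  have hsκ : t * (α * (b / σ ^ d) / m) ≤ κ₀ * t⁻¹ ^ 3 := by
    refine (mul_le_mul_of_nonneg_left hκ ht0.le).trans_eq ?_
    rw [show t * (κ₀ * t⁻¹ ^ 4) = (t * t⁻¹) * (κ₀ * t⁻¹ ^ 3) by ring, htt, one_mul]
  have hκt : κ₀ * t⁻¹ ≤ 1 / 4 := by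
    rw [← div_eq_mul_inv, div_le_iff₀ ht0]; linarith
  have hκt' : κ₀ * t⁻¹ ≤ δ / 2 := by
    rw [← div_eq_mul_inv, div_le_iff₀ ht0]
    rw [div_le_iff₀ hδ] at ht3
    linarith
  have c1 : t * (α * (b / σ ^ d) / m) ≤ 1 / 4 := by
    refine hsκ.trans (le_trans ?_ hκt)
    exact mul_le_mul_of_nonneg_left (pow_le_of_le_one hti0.le hti (by norm_num)) hκ₀0.le
  have c2 : t * (α * (b / σ ^ d) / m) * t ≤ δ / 2 := by
    refine (mul_le_mul_of_nonneg_right hsκ ht0.le).trans (le_trans ?_ hκt')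
    rw [show κ₀ * t⁻¹ ^ 3 * t = (t * t⁻¹) * (κ₀ * t⁻¹ ^ 2) by ring, htt, one_mul]
    exact mul_le_mul_of_nonneg_left (pow_le_of_le_one hti0.le hti (by norm_num)) hκ₀0.le
  have hq1 : 1 ≤ q := by
    have : (1 : ℝ) ≤ q := le_trans (by have : 0 < 2 / β := by positivity
                                       linarith) hq
    exact_mod_cast this
  set r : ℝ := d * (2 * Rb / (m ^ q : ℕ)) with hr
  have hr0 : 0 ≤ r := by positivity
  have hrle : r ≤ 2 * d * Rb := by
    have h1 : (1 : ℝ) ≤ (m ^ q : ℕ) := by exact_mod_cast Nat.one_le_pow _ _ hm0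
    rw [hr, show (2 : ℝ) * d * Rb = d * (2 * Rb) by ring]
    exact mul_le_mul_of_nonneg_left (div_le_self (by linarith) h1) (by linarith)
  have hσm : 1 / σ ≤ m := by
    rw [div_le_iff₀ hσ0]
    have h1 : (1 / (m : ℝ)) ^ (1 : ℝ) ≤ (1 / (m : ℝ)) ^ (1 / ((d : ℝ) * (1 + γ))) := by
      refine Real.rpow_le_rpow_of_exponent_ge (by positivity)
        (by rw [div_le_one hm']; exact hm1) ?_
      rw [div_le_one (by positivity)]
      exact one_le_mul_of_one_le_of_one_le hd' (by linarith)
    rw [Real.rpow_one, div_le_iff₀ hm'] at h1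
    exact (h1.trans (mul_le_mul_of_nonneg_right hσ hm'.le)).trans_eq (mul_comm _ _)
  have c3 : α * (A * (r / σ) ^ β / σ ^ d) ≤ δ := by
    have e3 : α / σ ^ d ≤ (Real.sqrt C₂)⁻¹ * m := by
      have : α / (m * σ ^ d) ≤ (Real.sqrt C₂)⁻¹ := hα4.trans
        (mul_le_of_le_one_right (by positivity) (pow_le_one₀ hti0.le hti))
      calc α / σ ^ d = α / (m * σ ^ d) * m := by field_simp
        _ ≤ _ := mul_le_mul_of_nonneg_right this hm'.le
    refine (holder_error_le hm0 hσ0 hσm hα hA hβ hq (by positivity : 0 ≤ 2 * d * Rb) e3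
      (by rw [hr]; push_cast; ring)).trans ?_
    rw [div_le_iff₀ hm']
    rw [div_le_iff₀ hδ] at hmH
    linarith
  have hmain := measure_not_metricsComparable_le hK hσ0 μ hμ hm0 (k := m ^ q) (s := t) (Λ := t)
    (Rb := Rb) hα hδ.le ht0.le c1 c2 ht4
    (by rw [hRb]; have := mul_le_mul_of_nonneg_left (hσ1.trans (le_abs_self σ₁)) hR; linarith)
    (by positivity) hr c3
  have hkd : ((m ^ q : ℕ) : ℝ) ^ d * m = (m : ℝ) ^ (q * d + 1) := by
    push_cast
    rw [← pow_mul, pow_succ]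
  refine le_trans (measure_mono ?_) (hmain.trans (ENNReal.ofReal_le_ofReal ?_))
  · intro U hU hcmp
    refine hU fun x y => ?_
    have hτ : ((m ^ q : ℕ) : ℝ) ^ d * (2 * r * Real.exp (δ - t / 2)) ≤ η / m := by
      rw [le_div_iff₀ hm']
      refine le_trans ?_ hp2
      rw [show δ - t / 2 = δ + -(1 / 2 * t) by ring, Real.exp_add, ← hkd]
      calc _ = (((m ^ q : ℕ) : ℝ) ^ d * m * Real.exp δ * Real.exp (-(1 / 2 * t))) * (2 * r) := by
            ring
        _ ≤ (((m ^ q : ℕ) : ℝ) ^ d * m * Real.exp δ * Real.exp (-(1 / 2 * t)))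
            * (2 * (2 * d * Rb)) := by gcongr
        _ = _ := by ring
    exact ⟨(hcmp x y).1.trans (by linarith), (hcmp x y).2.trans (by linarith)⟩
  · rw [le_div_iff₀ hm']
    refine le_trans (le_of_eq ?_) hp1
    rw [← hkd, show t * δ / 2 = δ / 2 * t by ring]
    ring

/-! ### Choice of constants and the final rate -/

lemma exists_cover_of_coveringNumber_le {D : Pt d → Pt d → ℝ} {S : Set (Pt d)} {ε r : ℝ}
    (h : ((coveringNumber D S ε : ℕ∞) : ℝ≥0∞) ≤ ENNReal.ofReal r) :
    ∃ c : Finset (Pt d), (∀ z ∈ S, ∃ x ∈ c, D x z ≤ ε) ∧ (c.card : ℝ≥0∞) ≤ ENNReal.ofReal r := by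
  have hne : coveringNumber D S ε ≠ ⊤ := by
    intro htop
    rw [htop] at h
    simp at h
  have hlt : coveringNumber D S ε < coveringNumber D S ε + 1 :=
    (ENat.lt_add_one_iff hne).2 le_rfl
  nth_rw 1 [coveringNumber] at hlt
  obtain ⟨c, hlt⟩ := iInf_lt_iff.1 hlt
  obtain ⟨hc, hlt⟩ := iInf_lt_iff.1 hlt
  refine ⟨c, hc, le_trans ?_ h⟩
  have := (ENat.lt_add_one_iff hne).1 hlt
  exact_mod_cast ENat.toENNReal_le.2 this

lemma bandwidth_eq (ξ : ℝ) (n : ℕ) :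
    bandwidth ξ n = Real.exp (-(2 * (2 - ξ)) / (2 + ξ)) * (1 / (n : ℝ)) ^ (1 / (2 + ξ)) := by
  rw [bandwidth, Real.mul_rpow (Nat.cast_nonneg n) (Real.exp_pos _).le, ← Real.exp_mul, mul_comm,
    one_div (n : ℝ), Real.inv_rpow (Nat.cast_nonneg n), ← Real.rpow_neg (Nat.cast_nonneg n)]
  congr 2 <;> ring

/-- The two bounds on `σ` are chained and raised to the power `d (1 + γ)`; the resulting exponent `d
(1 + γ) / (d - 1)` of `1/n` is at least `1`. -/
lemma one_div_le_of_admissible {K : ℝ → ℝ} {γ C₂ : ℝ} {n m : ℕ} {α σ : ℝ} (hd : 1 < d)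
    (hγ : 0 < γ) (hn : 0 < n) (hadm : Admissible d K γ C₂ n m α σ) :
    1 / (m : ℝ) ≤ (1 / (4 * kernelDiam d K)) ^ ((d : ℝ) * (1 + γ)) * (1 / (n : ℝ)) := by
  have hd' : (1 : ℝ) < d := by exact_mod_cast hd
  have hn1 : (1 : ℝ) ≤ n := by exact_mod_cast hn
  have hK : 0 ≤ kernelDiam d K := Metric.diam_nonneg
  have he : 0 < (d : ℝ) * (1 + γ) := by positivity
  have h1 := Real.rpow_le_rpow (by positivity) (hadm.sigma_ge.trans hadm.sigma_le) he.le
  rw [← Real.rpow_mul (by positivity), one_div_mul_cancel he.ne', Real.rpow_one,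
    Real.mul_rpow (by positivity) (by positivity), ← Real.rpow_mul (by positivity)] at h1
  refine h1.trans (mul_le_mul_of_nonneg_left ?_ (by positivity))
  have h2 := Real.rpow_le_rpow_of_exponent_ge (x := 1 / (n : ℝ)) (z := 1)
    (y := 1 / ((d : ℝ) - 1) * (d * (1 + γ))) (by positivity)
    (by rw [div_le_one (by linarith)]; exact hn1) (by
      rw [one_div_mul_eq_div, le_div_iff₀ (by linarith)]
      nlinarith)
  rwa [Real.rpow_one] at h2

section risk

variable {K : ℝ → ℝ} {L M α σ : ℝ}

lemma risk_estimator_le_of_measure_le (hσ : 0 < σ)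
    (hα : 0 ≤ α) (hL : 0 ≤ L) (hM : 0 < M) {b A β R : ℝ} (hK : KernelBounds d K b A β R)
    {P : ProbabilityMeasure (Pt d × ℝ)} (hP : P ∈ smoothClass d K L M α σ) {n m : ℕ} (hn : 0 < n)
    (hm : 0 < m) {a τ ε h : ℝ} (ha : 0 ≤ a) (hh : 0 < h) (hε : a * (2 * ε) + τ ≤ h)
    {c : Finset (Pt d)} (hc : ∀ z ∈ (marginal (P : Measure (Pt d × ℝ))).support, ∃ x ∈ c,
      populationMetric K α σ (P : Measure (Pt d × ℝ)) x z ≤ ε) {κ : ℝ≥0∞}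
    (hbad : Measure.pi (fun _ : Fin m => marginal (P : Measure (Pt d × ℝ)))
      {U | ¬ MetricsComparable a τ (populationMetric K α σ (P : Measure (Pt d × ℝ)))
        (estimatedMetric K α σ U)} ≤ κ) :
    risk P (fun (Z : Fin n → Pt d × ℝ) (U : Fin m → Pt d) => estimator K h α σ Z U)
      ≤ ENNReal.ofReal (12 * (L * (a * h + τ)) ^ 2) + ENNReal.ofReal (40 * M ^ 2 / n) * c.card
        + ENNReal.ofReal (4 * M ^ 2) * κ := by
  refine (lintegral_prod_le_add (F := fun (Z : Fin n → Pt d × ℝ) (U : Fin m → Pt d) =>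
    ∫⁻ x, ENNReal.ofReal ((estimator K h α σ Z U x - regression (P : Measure (Pt d × ℝ)) x) ^ 2)
      ∂(marginal (P : Measure (Pt d × ℝ)))) (b := ENNReal.ofReal (4 * M ^ 2))
    (bad := {U | ¬ MetricsComparable a τ (populationMetric K α σ (P : Measure (Pt d × ℝ)))
        (estimatedMetric K α σ U)}) (fun U hU => ?_) fun U => ?_).trans
    (add_le_add_right (mul_le_mul_right hbad _) _)
  · have hU' : MetricsComparable a τ (populationMetric K α σ (P : Measure (Pt d × ℝ)))
        (estimatedMetric K α σ U) := by
      by_contra hcon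
      exact hU hcon
    exact lintegral_risk_estimator_le hK hσ hα hL hM hP hn hm ha hh (fun x y => (hU' x y).1)
      (fun x y => (hU' x y).2) hε hc
  · simp_rw [estimator_eq_localAverage K hh]
    exact lintegral_risk_le_of_bounded hM (hP.1.mono fun z hz => hz.2) _ n

lemma risk_estimator_le_of_bounded (hM : 0 < M)
    {P : ProbabilityMeasure (Pt d × ℝ)} (hP : P ∈ smoothClass d K L M α σ) {n m : ℕ}
    {h : ℝ} (hh : 0 < h) :
    risk P (fun (Z : Fin n → Pt d × ℝ) (U : Fin m → Pt d) => estimator K h α σ Z U)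
      ≤ ENNReal.ofReal (4 * M ^ 2) := by
  refine (lintegral_prod_le_add (F := fun (Z : Fin n → Pt d × ℝ) (U : Fin m → Pt d) =>
    ∫⁻ x, ENNReal.ofReal ((estimator K h α σ Z U x - regression (P : Measure (Pt d × ℝ)) x) ^ 2)
      ∂(marginal (P : Measure (Pt d × ℝ)))) (a := ENNReal.ofReal (4 * M ^ 2))
      (b := ENNReal.ofReal (4 * M ^ 2)) (bad := ∅) (fun U _ => ?_) fun U => ?_).trans (by simp)
  all_goals
    simp_rw [estimator_eq_localAverage K hh]
    exact lintegral_risk_le_of_bounded hM (hP.1.mono fun z hz => hz.2) _ n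

end risk

open Filter Topology in
/-- The risk bound with an explicit power of `1/n`. -/
lemma exists_forall_risk_le {ξ γ L M c₁ C₁ C₂ : ℝ} {K : ℝ → ℝ}
    (hξ : 0 ≤ ξ) (hd : 1 < d) (hγ : 0 < γ) (hL : 0 ≤ L) (hM : 0 < M)
    (hc₁ : 0 < c₁) (hc₁' : c₁ < (1 / 2) * Real.exp (-(2 * (2 - ξ)) / (2 + ξ)))
    (hC₁ : 0 < C₁) (hC₂ : 0 < C₂) (hK : IsSmoothingKernel d K) :
    ∃ G : ℝ, 0 < G ∧ ∀ n m : ℕ, 0 < n → 0 < m → ∀ α σ : ℝ, Admissible d K γ C₂ n m α σ →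
      ∀ P ∈ coveringClass d K L M ξ c₁ C₁ n α σ,
        risk P (fun (Z : Fin n → Pt d × ℝ) (U : Fin m → Pt d) =>
            estimator K (bandwidth ξ n) α σ Z U)
          ≤ ENNReal.ofReal (G * ((1 / (n : ℝ)) ^ (1 / (2 + ξ))) ^ 2) := by
  obtain ⟨b, A, β, R, hKb⟩ := hK.exists_bounds
  set κ := Real.exp (-(2 * (2 - ξ)) / (2 + ξ)) with hκ
  have hκ0 : 0 < κ := Real.exp_pos _
  have hω0 : 0 < 1 / (2 + ξ) := by positivity
  have hω1 : 1 / (2 + ξ) ≤ 1 := by rw [div_le_one (by positivity)]; linarith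
  have hω2 : 1 / (2 + ξ) * 2 ≤ 1 := by
    rw [one_div_mul_eq_div, div_le_one (by positivity)]; linarith
  -- The bandwidth is `κ n^(-1/(2+ξ))`, so the strict inequality `2 c₁ < κ` leaves room for a factor
  -- `a > 1`. The remainder `c₃` below is the budget for the additive error.
  obtain ⟨a, ha1, ha2, hac⟩ : ∃ a : ℝ, 1 < a ∧ a ≤ 2 ∧ 2 * a * c₁ < κ := by
    have h1 : 1 < κ / (2 * c₁) := by rw [lt_div_iff₀ (by positivity)]; linarith
    obtain ⟨a, ha1, ha2⟩ := exists_between (lt_min one_lt_two h1)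
    refine ⟨a, ha1, (ha2.trans_le (min_le_left _ _)).le, ?_⟩
    have := ha2.trans_le (min_le_right _ _)
    rw [lt_div_iff₀ (by positivity)] at this
    linarith
  set c₃ := κ - 2 * a * c₁ with hc₃
  have hc₃0 : 0 < c₃ := by linarith
  have hc₃κ : c₃ ≤ κ := by
    have : 0 < 2 * a * c₁ := by positivity
    linarith
  have hδ : 0 < Real.log a / 3 := by have := Real.log_pos ha1; positivity
  have hexp : Real.exp (3 * (Real.log a / 3)) = a := by
    rw [mul_div_cancel₀ _ (by norm_num), Real.exp_log (by linarith)]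
  set σ₁ := 1 / (4 * kernelDiam d K) with hσ₁
  have hσ₁0 : 0 ≤ σ₁ := by
    have : 0 ≤ kernelDiam d K := Metric.diam_nonneg
    positivity
  set B := σ₁ ^ ((d : ℝ) * (1 + γ)) + 1 with hB
  have hB0 : 0 < B := by positivity
  obtain ⟨m₀, hm₀⟩ := exists_forall_measure_not_metricsComparable_le hKb (by omega) hγ hC₂ hδ
    (show 0 < c₃ / B by positivity) σ₁
  have hlim : Tendsto (fun n : ℕ => (1 / (n : ℝ)) ^ (1 / (2 + ξ))) atTop (𝓝 0) := by
    have := (tendsto_one_div_atTop_nhds_zero_nat (𝕜 := ℝ)).rpow_const (p := 1 / (2 + ξ))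
      (Or.inr hω0.le)
    rwa [Real.zero_rpow hω0.ne'] at this
  obtain ⟨n₀, hn₀⟩ := eventually_atTop.1
    ((hlim.eventually_lt_const (show 0 < C₁ / c₁ by positivity)).and
      (tendsto_natCast_atTop_atTop.eventually_ge_atTop (m₀ * B)))
  -- The summands pay for the bias, the variance, the failure of the metric comparison, and the
  -- finitely many `n < n₀`, where the trivial bound `4 M²` is used.
  set G := 108 * L ^ 2 * κ ^ 2 + 40 * M ^ 2 * (C₁ / c₁) ^ ξ + 4 * M ^ 2 * B
    + 4 * M ^ 2 * ((n₀ : ℝ) + 1) with hG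
  have t1 : 0 ≤ 108 * L ^ 2 * κ ^ 2 := by positivity
  have t2 : 0 ≤ 40 * M ^ 2 * (C₁ / c₁) ^ ξ := by positivity
  have t3 : 0 ≤ 4 * M ^ 2 * B := by positivity
  have t4 : 0 < 4 * M ^ 2 * ((n₀ : ℝ) + 1) := by positivity
  refine ⟨G, by linarith, fun n m hn hm α σ hadm P hP => ?_⟩
  have hn' : (0 : ℝ) < n := by exact_mod_cast hn
  have hm' : (0 : ℝ) < m := by exact_mod_cast hm
  have hn1 : (1 : ℝ) / n ≤ 1 := by
    rw [div_le_one hn']; exact_mod_cast hn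
  set N := (1 / (n : ℝ)) ^ (1 / (2 + ξ)) with hN
  have hN0 : 0 < N := by positivity
  have hnN : 1 / (n : ℝ) ≤ N := by
    have := Real.rpow_le_rpow_of_exponent_ge (by positivity) hn1 hω1
    rwa [Real.rpow_one] at this
  have hnN2 : 1 / (n : ℝ) ≤ N ^ 2 := by
    have := Real.rpow_le_rpow_of_exponent_ge (by positivity) hn1 hω2
    rwa [Real.rpow_one, Real.rpow_mul (by positivity), Real.rpow_two] at this
  have hh : bandwidth ξ n = κ * N := bandwidth_eq ξ n
  have hh0 : 0 < bandwidth ξ n := by rw [hh]; positivity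
  rcases lt_or_ge n n₀ with hlt | hge
  · refine (risk_estimator_le_of_bounded hM hP.1 hh0).trans (ENNReal.ofReal_le_ofReal ?_)
    have h1 : 1 ≤ ((n₀ : ℝ) + 1) * N ^ 2 := by
      have hle : (n : ℝ) ≤ n₀ + 1 := by
        have : (n : ℝ) < n₀ := by exact_mod_cast hlt
        linarith
      calc (1 : ℝ) = n * (1 / n) := by field_simp
        _ ≤ (n₀ + 1) * N ^ 2 := by gcongr
    have h2 : 4 * M ^ 2 * ((n₀ : ℝ) + 1) ≤ G := by linarith
    calc 4 * M ^ 2 ≤ 4 * M ^ 2 * (((n₀ : ℝ) + 1) * N ^ 2) :=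
          le_mul_of_one_le_right (by positivity) h1
      _ = 4 * M ^ 2 * ((n₀ : ℝ) + 1) * N ^ 2 := by ring
      _ ≤ G * N ^ 2 := mul_le_mul_of_nonneg_right h2 (sq_nonneg N)
  obtain ⟨hN1, hnm⟩ := hn₀ n hge
  have hmn : 1 / (m : ℝ) ≤ B * (1 / n) := by
    refine (one_div_le_of_admissible hd hγ hn hadm).trans
      (mul_le_mul_of_nonneg_right ?_ (by positivity))
    rw [hB]
    linarith
  -- Since `n ≤ B m`, a large `n` forces a large `m`, so a threshold on `n` alone is enough.
  have hmm₀ : m₀ ≤ m := by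
    rw [mul_one_div, div_le_div_iff₀ hm' hn', one_mul] at hmn
    have h1 := hnm.trans hmn
    rw [mul_comm] at h1
    exact_mod_cast le_of_mul_le_mul_left h1 hB0
  have hσ0 : 0 < σ := lt_of_lt_of_le (by positivity) hadm.sigma_ge
  have hσσ₁ : σ ≤ σ₁ := by
    refine hadm.sigma_le.trans (mul_le_of_le_one_right hσ₁0 ?_)
    refine Real.rpow_le_one (by positivity) hn1 ?_
    have : (1 : ℝ) < d := by exact_mod_cast hd
    have : (0 : ℝ) < d - 1 := by linarith
    positivity
  have hcube : ∀ᵐ x ∂(marginal (P : Measure (Pt d × ℝ))), x ∈ cube d :=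
    (ae_map_iff measurable_fst.aemeasurable (measurableSet_cube d)).2 (hP.1.1.mono fun z hz => hz.1)
  have hbad := hm₀ m hmm₀ α σ hadm.alpha_nonneg hadm.alpha_le hadm.sigma_ge hσσ₁ _ hcube
  rw [hexp] at hbad
  have hε1 : c₁ * N ≤ C₁ := by
    rw [lt_div_iff₀ hc₁] at hN1
    linarith
  obtain ⟨c, hc, hcard⟩ := exists_cover_of_coveringNumber_le (hP.2 (c₁ * N) le_rfl hε1)
  have hτ : c₃ / B / m ≤ c₃ * N := by
    calc c₃ / B / m = c₃ / B * (1 / m) := by ring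
      _ ≤ c₃ / B * (B * (1 / n)) := by gcongr
      _ = c₃ * (1 / n) := by field_simp
      _ ≤ c₃ * N := by gcongr
  have hrisk := risk_estimator_le_of_measure_le hσ0 hadm.alpha_nonneg hL hM hKb hP.1 hn hm
    (h := bandwidth ξ n) (by linarith) hh0 (by
      rw [hh]
      calc a * (2 * (c₁ * N)) + c₃ / B / m ≤ a * (2 * (c₁ * N)) + c₃ * N := by gcongr
        _ = κ * N := by rw [hc₃]; ring) hc hbad
  refine hrisk.trans ?_
  have e1 : 12 * (L * (a * bandwidth ξ n + c₃ / B / m)) ^ 2 ≤ 108 * L ^ 2 * κ ^ 2 * N ^ 2 := by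
    have h1 : a * bandwidth ξ n + c₃ / B / m ≤ 3 * (κ * N) := by
      have h2 : a * (κ * N) ≤ 2 * (κ * N) := by gcongr
      have h3 : c₃ * N ≤ κ * N := by gcongr
      rw [hh]
      linarith
    calc _ ≤ 12 * (L * (3 * (κ * N))) ^ 2 := by gcongr
      _ = _ := by ring
  have e2 : 40 * M ^ 2 / n * (C₁ / (c₁ * N)) ^ ξ = 40 * M ^ 2 * (C₁ / c₁) ^ ξ * N ^ 2 := by
    -- The balance behind the rate: `N^(2+ξ) = 1/n`, and the covering number contributes `N^(-ξ)`.
    have hNn : 1 / (n : ℝ) = N ^ 2 * N ^ ξ := by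
      rw [← Real.rpow_two, ← Real.rpow_add hN0, hN, ← Real.rpow_mul (by positivity),
        one_div_mul_cancel (by positivity), Real.rpow_one]
    rw [← div_div, Real.div_rpow (by positivity) hN0.le, div_eq_mul_one_div _ (n : ℝ), hNn]
    have : N ^ ξ ≠ 0 := by positivity
    field_simp
  have e3 : 4 * M ^ 2 * (1 / m) ≤ 4 * M ^ 2 * B * N ^ 2 := by
    rw [mul_assoc (4 * M ^ 2)]
    exact mul_le_mul_of_nonneg_left
      (hmn.trans (mul_le_mul_of_nonneg_left hnN2 hB0.le)) (by positivity)
  calc _ ≤ ENNReal.ofReal (108 * L ^ 2 * κ ^ 2 * N ^ 2)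
        + ENNReal.ofReal (40 * M ^ 2 / n) * ENNReal.ofReal ((C₁ / (c₁ * N)) ^ ξ)
        + ENNReal.ofReal (4 * M ^ 2) * ENNReal.ofReal (1 / m) := by gcongr
    _ = ENNReal.ofReal (108 * L ^ 2 * κ ^ 2 * N ^ 2
        + 40 * M ^ 2 / n * (C₁ / (c₁ * N)) ^ ξ + 4 * M ^ 2 * (1 / m)) := by
      rw [← ENNReal.ofReal_mul (by positivity), ← ENNReal.ofReal_mul (by positivity),
        ← ENNReal.ofReal_add (by positivity) (by positivity),
        ← ENNReal.ofReal_add (by positivity) (by positivity)]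
    _ ≤ _ := by
      refine ENNReal.ofReal_le_ofReal ?_
      rw [e2, hG]
      have := mul_nonneg t4.le (sq_nonneg N)
      linarith

end DensitySensitive

end

theorem mainTheorem4 (d : ℕ) (ξ γ L M c₁ C₁ C₂ : ℝ) (K : ℝ → ℝ)
    (hξ : 0 ≤ ξ) (hξd : ξ < (d : ℝ) - 3) (hγ : 0 < γ) (hL : 0 < L) (hM : 0 < M)
    (hc₁ : 0 < c₁) (hc₁' : c₁ < (1 / 2) * Real.exp (-(2 * (2 - ξ)) / (2 + ξ)))
    (hC₁ : 0 < C₁) (hC₂ : 0 < C₂)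
    (hK : DensitySensitive.IsSmoothingKernel d K) :
    ∃ C : ℝ, 0 < C ∧ ∀ n m : ℕ, 0 < n → 0 < m →
      (⨆ (α : ℝ) (σ : ℝ) (_ : DensitySensitive.Admissible d K γ C₂ n m α σ)
        (P : MeasureTheory.ProbabilityMeasure (DensitySensitive.Pt d × ℝ))
        (_ : P ∈ DensitySensitive.coveringClass d K L M ξ c₁ C₁ n α σ),
        DensitySensitive.risk P
          (fun (Z : Fin n → DensitySensitive.Pt d × ℝ) (U : Fin m → DensitySensitive.Pt d) =>
            DensitySensitive.estimator K (DensitySensitive.bandwidth ξ n) α σ Z U))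
        ≤ ENNReal.ofReal ((C / (n : ℝ)) ^ (2 / (2 + ξ))) := by
  have hd : 1 < d := by
    have : (1 : ℝ) < d := by linarith
    exact_mod_cast this
  obtain ⟨G, hG, h⟩ := DensitySensitive.exists_forall_risk_le hξ hd hγ hL.le hM hc₁ hc₁' hC₁ hC₂ hK
  -- The power is undone by the exponent `2 / (2 + ξ)` of the rate.
  refine ⟨G ^ ((2 + ξ) / 2), by positivity, fun n m hn hm => ?_⟩
  refine iSup_le fun α => iSup_le fun σ => iSup_le fun hadm => iSup_le fun P => iSup_le fun hP => ?_
  refine (h n m hn hm α σ hadm P hP).trans (le_of_eq ?_)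
  congr 1
  rw [div_eq_mul_one_div (G ^ _), Real.mul_rpow (by positivity) (by positivity),
    ← Real.rpow_mul hG.le, show (2 + ξ) / 2 * (2 / (2 + ξ)) = 1 by field_simp, Real.rpow_one,
    ← Real.rpow_two, ← Real.rpow_mul (by positivity)]
  congr 2
  ring
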